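/- **Proposition (existence of a discrete solution for $k=1$, Cauchy problem).** Let $d\in\{2,3\}$ and let $\Omega\subset\mathbb{R}^d$ be a (nonempty, connected) polygonal/polyhedral domain with $\operatorname{int}\overline\Omega=\Omega$, and let $\mathcal{T}_h$ be a conforming triangulation of $\overline\Omega$ into finitely many nondegenerate closed $d$-simplices $K$, with $h=\max_K \operatorname{diam}K$. Let $\mathcal F_{int}$ be the set of interior $(d-1)$-faces and $h_F=\operatorname{diam}F$. Let $\Gamma_V,\Gamma_W\subset\partial\Omega$ be disjoint connected measurable sets, both of positive surface measure, with $\partial\Omega=\overline{\Gamma}_V\cup\overline{\Gamma}_W$. Let $\kappa\in\mathbb{R}$, let $\gamma_{1,F},\gamma_{2,F}>0$ for $F\in\mathcal F_{int}$, and let $n$ be the outward unit normal on $\partial\Omega$. For $k\ge 0$ let $$X_h^k=\{v\in C^0(\Omega): v|_{K\cap\Omega}\text{ is a polynomial of degree at most }k\text{ for all }K\in\mathcal T_h\}$$ be the space of continuous piecewise polynomials, and define $$a_h(u,v)=\int_\Omega\nabla u\cdot\nabla v\,dx+\kappa\int_\Omega uv\,dx-\int_{\Gamma_V}(\nabla v\cdot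 n)\,u\,ds-\int_{\Gamma_W}(\nabla u\cdot n)\,v\,ds,$$ $$s_{cip}(u,v)=\sum_{F\in\mathcal F_{int}}\int_F\Big(h_F\gamma_{1,F}[\nabla u]\cdot[\nabla v]+h_F^3\gamma_{2,F}[\Delta u][\Delta v]\Big)ds,$$ where $[\cdot]$ is the jump across $F$ and boundary values and derivatives on faces are traces from inside the elements, and $$s_p(u,v)=s_{cip}(u,v)+\int_{\Gamma_V}\big(h^{-1}uv+h(\nabla u\cdot n)(\nabla v\cdot n)\big)ds,\qquad s_a(u,v)=s_{cip}(u,v)+\int_{\Gamma_W}\big(h^{-1}uv+h(\nabla u\cdot n)(\nabla v\cdot n)\big)ds.$$ Let $V_h=X_h^1$. Then for every $f\in L^2(\Omega)$ and every function $u$ on $\Omega$ that is sufficiently regular for $s_p(u,\cdot)$ to be well defined on $V_h$ (all integrals occurring in it converge absolutely), for instance a sufficiently regular solution of $-\Delta u+\kappa u=f$ in $\Omega$, $u=\nabla u\cdot n=0$ on $\Gamma_V$, there is exactly one pair $(u_h,z_h)\in V_h\times V_h$ such that $$a_h(u_h,w_h)+s_a(z_h,w_h)=(f,w_h)_{L^2(\Omega)}\quad\text{for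 all }w_h\in V_h,$$ $$a_h(v_h,z_h)-s_p(u_h,v_h)=-s_p(u,v_h)\quad\text{for all }v_h\in V_h.$$ -/

import Mathlib

open MeasureTheory Set Filter Topology

namespace CauchyFEM

noncomputable section

/-- Euclidean space of dimension `d`. -/
abbrev Pt (d : ℕ) : Type := EuclideanSpace ℝ (Fin d)

/-- A conforming triangulation of the closure of `Ω`: a finite simplicial complex, each of whose
simplices is a face of a `d`-dimensional one, with underlying space `closure Ω`. A simplex is
represented by the finite set of its vertices; the simplex itself is the convex hull. -/
structure Triangulation {d : ℕ} (Ω : Set (Pt d)) extends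
    Geometry.SimplicialComplex ℝ (Pt d) where
  finite_faces : faces.Finite
  pure : ∀ s ∈ faces, ∃ t ∈ faces, s ⊆ t ∧ t.card = d + 1
  space_eq : toSimplicialComplex.space = closure Ω

/-- The closed simplex with the given vertices. -/
def hull {d : ℕ} (T : Finset (Pt d)) : Set (Pt d) := convexHull ℝ (T : Set (Pt d))

/-- The trace from inside the simplex `T`, at the point `x` of `T`, of a function `g` defined
almost everywhere on `T`: the limit of the averages of `g` over `B(x, r) ∩ T` as `r → 0+`.
It is the one-sided limit if `g` has a continuous extension to `T`, and it is the Sobolev trace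
(almost everywhere on the boundary of `T`) if `g` is a Sobolev function on `T`. -/
def cellTrace {d : ℕ} {G : Type} [NormedAddCommGroup G] [NormedSpace ℝ G]
    (T : Finset (Pt d)) (g : Pt d → G) (x : Pt d) : G :=
  limUnder (𝓝[>] (0 : ℝ)) fun r : ℝ => ⨍ y in Metric.ball x r ∩ interior (hull T), g y

/-- The unit normal at a point `x` of the face `T.erase a` of the simplex `T`, pointing out of `T`:
the normalised component of `x - a` orthogonal to that face, where `a` is the opposite vertex. -/
def outerNormal {d : ℕ} (T : Finset (Pt d)) (a x : Pt d) : Pt d :=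
  let w : Pt d := ((vectorSpan ℝ ((T : Set (Pt d)) \ {a}))ᗮ).starProjection (x - a)
  ‖w‖⁻¹ • w

/-- The outward normal derivative `∇v · n` of `v` on the face of `T` opposite to `a`, with the
gradient taken from inside `T`. -/
def normalDeriv {d : ℕ} (T : Finset (Pt d)) (a : Pt d) (v : Pt d → ℝ) (x : Pt d) : ℝ :=
  inner ℝ (cellTrace T (gradient v) x) (outerNormal T a x)

namespace Triangulation

variable {d : ℕ} {Ω : Set (Pt d)} (𝓣 : Triangulation Ω)

/-- The elements `K` of the triangulation: its `d`-dimensional simplices. -/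
def cells : Finset (Finset (Pt d)) :=
  𝓣.finite_faces.toFinset.filter fun T => T.card = d + 1

open Classical in
/-- The elements having `F` as a face. -/
def cellsOn (F : Finset (Pt d)) : Finset (Finset (Pt d)) :=
  𝓣.cells.filter fun T => F ⊆ T

/-- The interior faces: the `(d-1)`-dimensional simplices shared by two elements. -/
def interiorFaces : Finset (Finset (Pt d)) :=
  𝓣.finite_faces.toFinset.filter fun F => F.card = d ∧ (𝓣.cellsOn F).card = 2

/-- The boundary faces: the `(d-1)`-dimensional simplices lying on one element only. -/
def boundaryFaces : Finset (Finset (Pt d)) :=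
  𝓣.finite_faces.toFinset.filter fun F => F.card = d ∧ (𝓣.cellsOn F).card = 1

open Classical in
/-- The vertices `a` of `T` for which the face of `T` opposite to `a` is a boundary face. -/
def boundaryVertices (T : Finset (Pt d)) : Finset (Pt d) :=
  T.filter fun a => T.erase a ∈ 𝓣.boundaryFaces

/-- The mesh parameter `h = max_K diam K`. -/
def meshSize : ℝ := sSup ((fun T => Metric.diam (hull T)) '' (𝓣.cells : Set (Finset (Pt d))))

/-- The finite element space of continuous functions on `Ω` whose restriction to every element is
a polynomial of degree at most `k`. As a normalisation, the functions are
extended by zero outside `Ω`, so that equality of functions means equality on `Ω`. -/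
def feSpace (k : ℕ) : Submodule ℝ (Pt d → ℝ) where
  carrier := {v | (∀ x ∉ Ω, v x = 0) ∧ ContinuousOn v Ω ∧
    ∀ T ∈ 𝓣.cells, ∃ p : MvPolynomial (Fin d) ℝ, p.totalDegree ≤ k ∧
      ∀ x ∈ hull T ∩ Ω, v x = MvPolynomial.eval (fun i => x i) p}
  zero_mem' := ⟨fun _ _ => rfl, continuousOn_const, fun _ _ => ⟨0, by simp, by simp⟩⟩
  add_mem' := by
    rintro v w ⟨hv0, hvc, hvp⟩ ⟨hw0, hwc, hwp⟩
    refine ⟨fun x hx => by simp [hv0 x hx, hw0 x hx], hvc.add hwc, fun T hT => ?_⟩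
    obtain ⟨p, hp, hpv⟩ := hvp T hT
    obtain ⟨q, hq, hqw⟩ := hwp T hT
    exact ⟨p + q, (MvPolynomial.totalDegree_add p q).trans (max_le hp hq),
      fun x hx => by simp [hpv x hx, hqw x hx]⟩
  smul_mem' := by
    rintro c v ⟨hv0, hvc, hvp⟩
    refine ⟨fun x hx => by simp [hv0 x hx], hvc.const_smul c, fun T hT => ?_⟩
    obtain ⟨p, hp, hpv⟩ := hvp T hT
    exact ⟨c • p, (MvPolynomial.totalDegree_smul_le c p).trans hp,
      fun x hx => by simp [hpv x hx]⟩

/-- The product `[∇u] · [∇v]` of gradient jumps on an interior face `F`. For the two elements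
`T₁`, `T₂` sharing `F`, the sum over ordered pairs counts
`(∇u|T₁ - ∇u|T₂) · (∇v|T₁ - ∇v|T₂)` twice. -/
def gradJumpProd (F : Finset (Pt d)) (u v : Pt d → ℝ) (x : Pt d) : ℝ :=
  1 / 2 * ∑ T ∈ 𝓣.cellsOn F, ∑ T' ∈ 𝓣.cellsOn F,
    inner ℝ (cellTrace T (gradient u) x - cellTrace T' (gradient u) x)
      (cellTrace T (gradient v) x - cellTrace T' (gradient v) x)

/-- The product `[Δu] [Δv]` of the jumps of the Laplacians on an interior face `F`. -/
def lapJumpProd (F : Finset (Pt d)) (u v : Pt d → ℝ) (x : Pt d) : ℝ :=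
  1 / 2 * ∑ T ∈ 𝓣.cellsOn F, ∑ T' ∈ 𝓣.cellsOn F,
    (cellTrace T (Laplacian.laplacian u) x - cellTrace T' (Laplacian.laplacian u) x) *
      (cellTrace T (Laplacian.laplacian v) x - cellTrace T' (Laplacian.laplacian v) x)

/-- The integral over the part `Γ` of the boundary, with respect to surface measure, of a function
given facewise: `g T a` is its expression on the boundary face of `T` opposite to `a`. -/
def boundaryIntegral (Γ : Set (Pt d)) (g : Finset (Pt d) → Pt d → Pt d → ℝ) : ℝ :=
  ∑ T ∈ 𝓣.cells, ∑ a ∈ 𝓣.boundaryVertices T,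
    ∫ x in convexHull ℝ ((T : Set (Pt d)) \ {a}) ∩ Γ, g T a x ∂μHE[d - 1]

/-- The discrete bilinear form
`a_h(u,v) = (∇u,∇v) + κ (u,v) - ⟨∇v·n, u⟩_{Γ_V} - ⟨∇u·n, v⟩_{Γ_W}`. -/
def aForm (κ : ℝ) (ΓV ΓW : Set (Pt d)) (u v : Pt d → ℝ) : ℝ :=
  (∫ x in Ω, inner ℝ (gradient u x) (gradient v x)) + κ * (∫ x in Ω, u x * v x)
    - 𝓣.boundaryIntegral ΓV (fun T a x => normalDeriv T a v x * cellTrace T u x)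
    - 𝓣.boundaryIntegral ΓW (fun T a x => normalDeriv T a u x * cellTrace T v x)

/-- The interior penalty form
`s_cip(u,v) = ∑_F ∫_F (h_F γ₁ [∇u]·[∇v] + h_F³ γ₂ [Δu][Δv]) ds` over the interior faces. -/
def sCip (γ₁ γ₂ : Finset (Pt d) → ℝ) (u v : Pt d → ℝ) : ℝ :=
  ∑ F ∈ 𝓣.interiorFaces, ∫ x in hull F,
    (Metric.diam (hull F) * γ₁ F * 𝓣.gradJumpProd F u v x
      + Metric.diam (hull F) ^ 3 * γ₂ F * 𝓣.lapJumpProd F u v x) ∂μHE[d - 1]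

/-- The boundary penalty form `∫_Γ (h⁻¹ u v + h (∇u·n) (∇v·n)) ds`. -/
def sBc (Γ : Set (Pt d)) (u v : Pt d → ℝ) : ℝ :=
  𝓣.boundaryIntegral Γ fun T a x =>
    𝓣.meshSize⁻¹ * (cellTrace T u x * cellTrace T v x)
      + 𝓣.meshSize * (normalDeriv T a u x * normalDeriv T a v x)

/-- The stabilisation `s_cip + s_bc` with boundary penalty on `Γ`; it is `s_p` for `Γ = Γ_V` and
`s_a` for `Γ = Γ_W`. -/
def sForm (γ₁ γ₂ : Finset (Pt d) → ℝ) (Γ : Set (Pt d)) (u v : Pt d → ℝ) : ℝ :=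
  𝓣.sCip γ₁ γ₂ u v + 𝓣.sBc Γ u v

/-- `u` is sufficiently regular for the stabilisation `s(u, ·)` with boundary penalty on `Γ` to be
well defined on the finite element space of order `k`: every integral occurring in `s(u, w)`
converges absolutely. -/
def StabDefined (k : ℕ) (Γ : Set (Pt d)) (u : Pt d → ℝ) : Prop :=
  ∀ w ∈ 𝓣.feSpace k,
    (∀ F ∈ 𝓣.interiorFaces,
      IntegrableOn (𝓣.gradJumpProd F u w) (hull F) μHE[d - 1] ∧
      IntegrableOn (𝓣.lapJumpProd F u w) (hull F) μHE[d - 1]) ∧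
    ∀ T ∈ 𝓣.cells, ∀ a ∈ 𝓣.boundaryVertices T,
      IntegrableOn (fun x => cellTrace T u x * cellTrace T w x)
        (convexHull ℝ ((T : Set (Pt d)) \ {a}) ∩ Γ) μHE[d - 1] ∧
      IntegrableOn (fun x => normalDeriv T a u x * normalDeriv T a w x)
        (convexHull ℝ ((T : Set (Pt d)) \ {a}) ∩ Γ) μHE[d - 1]

/-- `(uh, zh)` solves the discrete system with load `f` and stabilisation data `s_p(u, ·)`. -/
def IsFEMSolution (k : ℕ) (κ : ℝ) (γ₁ γ₂ : Finset (Pt d) → ℝ) (ΓV ΓW : Set (Pt d))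
    (f u uh zh : Pt d → ℝ) : Prop :=
  (∀ w ∈ 𝓣.feSpace k,
    𝓣.aForm κ ΓV ΓW uh w + 𝓣.sForm γ₁ γ₂ ΓW zh w = ∫ x in Ω, f x * w x) ∧
  (∀ v ∈ 𝓣.feSpace k,
    𝓣.aForm κ ΓV ΓW v zh - 𝓣.sForm γ₁ γ₂ ΓV uh v = - 𝓣.sForm γ₁ γ₂ ΓV u v)

end Triangulation

/-- The splitting of the boundary of `Ω` into the part `Γ_V` carrying the Cauchy data of the primal
problem and the part `Γ_W` carrying those of the dual problem. -/
structure IsCauchySplitting {d : ℕ} (Ω ΓV ΓW : Set (Pt d)) : Prop where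
  connected_V : IsConnected ΓV
  connected_W : IsConnected ΓW
  disjoint : ΓV ∩ ΓW = ∅
  cover : frontier Ω = closure ΓV ∪ closure ΓW
  subset_V : ΓV ⊆ frontier Ω
  subset_W : ΓW ⊆ frontier Ω
  measurable_V : MeasurableSet ΓV
  measurable_W : MeasurableSet ΓW
  measure_pos_V : 0 < (μHE[d - 1] : Measure (Pt d)) ΓV
  measure_pos_W : 0 < (μHE[d - 1] : Measure (Pt d)) ΓW

end

end CauchyFEM

/-!
The discrete system is a square linear system, so it suffices that the homogeneous one has only the
zero solution. Testing its first equation with `z_h` and its second one with `u_h` and subtracting,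
the indefinite form `a_h` cancels and leaves `s_p(u_h, u_h) + s_a(z_h, z_h) = 0`, so everything
rests on the definiteness of the stabilisation on piecewise affine functions. If `s(v, v) = 0`, the
interior penalty removes all jumps of the gradient. As the simplices of codimension at least two do
not disconnect `Ω`, any two elements are joined through interior faces, so `v` is affine on `Ω`. The
boundary penalty makes `v` and `∇v · n` vanish on a part of positive measure of some boundary face;
an affine function vanishing there vanishes on the whole face, and with its normal derivative zero
as well it is identically zero.
-/

namespace CauchyFEM

noncomputable section

/-! ### Finite-dimensional saddle point systems and linear functionals -/

section SaddlePoint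

variable {𝕜 V W : Type*} [Field 𝕜] [LinearOrder 𝕜] [IsStrictOrderedRing 𝕜]
  [AddCommGroup V] [Module 𝕜 V] [FiniteDimensional 𝕜 V]
  [AddCommGroup W] [Module 𝕜 W] [FiniteDimensional 𝕜 W]

lemma existsUnique_saddlePoint (a : V →ₗ[𝕜] W →ₗ[𝕜] 𝕜)
    {s : V →ₗ[𝕜] V →ₗ[𝕜] 𝕜} (hs : ∀ v, v ≠ 0 → 0 < s v v)
    {t : W →ₗ[𝕜] W →ₗ[𝕜] 𝕜} (ht : ∀ w, w ≠ 0 → 0 < t w w)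
    (l : W →ₗ[𝕜] 𝕜) (m : V →ₗ[𝕜] 𝕜) :
    ∃! p : V × W, (∀ w, a p.1 w + t p.2 w = l w) ∧ ∀ v, a v p.2 - s p.1 v = m v := by
  let Φ : V × W →ₗ[𝕜] Module.Dual 𝕜 W × Module.Dual 𝕜 V :=
    (a.coprod t).prod ((-s).coprod a.flip)
  have hΦ_iff (p : V × W) : Φ p = (l, m) ↔
      (∀ w, a p.1 w + t p.2 w = l w) ∧ ∀ v, a v p.2 - s p.1 v = m v := by
    simp [Φ, Prod.ext_iff, LinearMap.ext_iff, sub_eq_neg_add]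
  have hΦ_inj : Function.Injective Φ := by
    refine (injective_iff_map_eq_zero Φ).2 fun p hp => ?_
    have h₁ : a p.1 p.2 + t p.2 p.2 = 0 := LinearMap.congr_fun (congrArg Prod.fst hp) p.2
    have h₂ : -s p.1 p.1 + a p.1 p.2 = 0 := LinearMap.congr_fun (congrArg Prod.snd hp) p.1
    have hsum : s p.1 p.1 + t p.2 p.2 = 0 := by linear_combination h₁ - h₂
    have hs_nonneg : 0 ≤ s p.1 p.1 := by
      rcases eq_or_ne p.1 0 with h | h
      · simp [h]
      · exact (hs _ h).le
    have ht_nonneg : 0 ≤ t p.2 p.2 := by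
      rcases eq_or_ne p.2 0 with h | h
      · simp [h]
      · exact (ht _ h).le
    refine Prod.ext (by_contra fun h => ?_) (by_contra fun h => ?_)
    · exact (add_pos_of_pos_of_nonneg (hs _ h) ht_nonneg).ne' hsum
    · exact (add_pos_of_nonneg_of_pos hs_nonneg (ht _ h)).ne' hsum
  have hΦ_surj : Function.Surjective Φ :=
    (LinearMap.injective_iff_surjective_of_finrank_eq_finrank (by
      simp [Module.finrank_prod, Subspace.dual_finrank_eq, add_comm])).1 hΦ_inj
  simp only [← hΦ_iff]
  exact Function.Bijective.existsUnique ⟨hΦ_inj, hΦ_surj⟩ _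

end SaddlePoint

section LinearMaps

variable {M : Type*} [AddCommGroup M] [Module ℝ M]

lemma isLinearMap_add {N : Type*} [AddCommGroup N] [Module ℝ N] {f g : M → N}
    (hf : IsLinearMap ℝ f) (hg : IsLinearMap ℝ g) : IsLinearMap ℝ fun v => f v + g v :=
  (hf.mk' f + hg.mk' g).isLinear

lemma isLinearMap_sub {N : Type*} [AddCommGroup N] [Module ℝ N] {f g : M → N}
    (hf : IsLinearMap ℝ f) (hg : IsLinearMap ℝ g) : IsLinearMap ℝ fun v => f v - g v :=
  (hf.mk' f - hg.mk' g).isLinear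

lemma isLinearMap_const_mul {f : M → ℝ} (c : ℝ) (hf : IsLinearMap ℝ f) :
    IsLinearMap ℝ fun v => c * f v :=
  (c • hf.mk' f).isLinear

lemma isLinearMap_inner_right {E : Type*} [NormedAddCommGroup E] [InnerProductSpace ℝ E] {f : M → E}
    (hf : IsLinearMap ℝ f) (y : E) : IsLinearMap ℝ fun v => inner ℝ y (f v) :=
  (innerₛₗ ℝ y ∘ₗ hf.mk' f).isLinear

lemma isLinearMap_inner_left {E : Type*} [NormedAddCommGroup E] [InnerProductSpace ℝ E] {f : M → E}
    (hf : IsLinearMap ℝ f) (y : E) : IsLinearMap ℝ fun v => inner ℝ (f v) y := by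
  simpa only [real_inner_comm] using isLinearMap_inner_right hf y

lemma isLinearMap_sum {ι : Type*} {s : Finset ι} {f : ι → M → ℝ}
    (hf : ∀ i ∈ s, IsLinearMap ℝ (f i)) : IsLinearMap ℝ fun v => ∑ i ∈ s, f i v where
  map_add v w := by
    rw [← Finset.sum_add_distrib]
    exact Finset.sum_congr rfl fun i hi => (hf i hi).map_add v w
  map_smul r v := by
    rw [Finset.smul_sum]
    exact Finset.sum_congr rfl fun i hi => (hf i hi).map_smul r v

lemma isLinearMap_integral {α : Type*} [MeasurableSpace α] {μ : Measure α} {f : α → M → ℝ}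
    (hlin : ∀ᵐ x ∂μ, IsLinearMap ℝ (f x)) (hint : ∀ v, Integrable (fun x => f x v) μ) :
    IsLinearMap ℝ fun v => ∫ x, f x v ∂μ where
  map_add v w := by
    rw [← integral_add (hint v) (hint w)]
    exact integral_congr_ae (hlin.mono fun x hx => hx.map_add v w)
  map_smul r v := by
    rw [← integral_smul]
    exact integral_congr_ae (hlin.mono fun x hx => hx.map_smul r v)

lemma isBilinearMap_of_isLinearMap {N : Type*} [AddCommGroup N] [Module ℝ N] {f : M → N → ℝ}
    (hleft : ∀ w, IsLinearMap ℝ fun v => f v w) (hright : ∀ v, IsLinearMap ℝ (f v)) :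
    IsBilinearMap ℝ f where
  add_left v₁ v₂ w := (hleft w).map_add v₁ v₂
  smul_left r v w := (hleft w).map_smul r v
  add_right v w₁ w₂ := (hright v).map_add w₁ w₂
  smul_right r v w := (hright v).map_smul r w

end LinearMaps

/-! ### Affine maps and Hausdorff measure of convex sets -/

section ConvexHull

variable {E : Type*} [AddCommGroup E] [Module ℝ E]

lemma vectorSpan_convexHull (s : Set E) :
    vectorSpan ℝ (convexHull ℝ s) = vectorSpan ℝ s := by
  rw [← direction_affineSpan, affineSpan_convexHull, direction_affineSpan]

lemma finrank_vectorSpan_convexHull {s : Finset E} (hs : AffineIndependent ℝ ((↑) : s → E))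
    {m : ℕ} (hm : s.card = m + 1) :
    Module.finrank ℝ (vectorSpan ℝ (convexHull ℝ (s : Set E))) = m := by
  have hrank := hs.finrank_vectorSpan ((Fintype.card_coe s).trans hm)
  rwa [show range ((↑) : s → E) = (s : Set E) from Subtype.range_coe,
    ← vectorSpan_convexHull] at hrank

lemma mem_affineSpan_insert_of_mem_segment {y z x : E} {s : Set E} (hx : x ∈ segment ℝ y z)
    (hxs : x ∈ affineSpan ℝ s) (hys : y ∉ affineSpan ℝ s) :
    z ∈ affineSpan ℝ (insert y s) := by
  rw [segment_eq_image_lineMap] at hx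
  obtain ⟨t, -, rfl⟩ := hx
  have ht : t ≠ 0 := by
    rintro rfl
    exact hys (by simpa using hxs)
  have hmem := AffineMap.lineMap_mem t⁻¹ (mem_affineSpan ℝ (mem_insert y s))
    (affineSpan_mono ℝ (subset_insert y s) hxs)
  simpa [AffineMap.lineMap_apply, smul_smul, ht] using hmem

end ConvexHull

section HausdorffMeasure

variable {E : Type*} [NormedAddCommGroup E] [InnerProductSpace ℝ E] [FiniteDimensional ℝ E]
  [MeasurableSpace E] [BorelSpace E]

lemma euclideanHausdorffMeasure_eq_zero_of_finrank_lt {s : Set E} (hs : Convex ℝ s) {m : ℕ}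
    (hm : Module.finrank ℝ (vectorSpan ℝ s) < m) : (μHE[m] : Measure E) s = 0 := by
  rcases s.eq_empty_or_nonempty with rfl | hne
  · simp
  have hdim : dimH s < (m : NNReal) := by
    rw [Real.Convex.dimH_eq_finrank_vectorSpan hs hne]
    exact_mod_cast hm
  rw [Measure.euclideanHausdorffMeasure_def]
  simpa using Or.inr (hausdorffMeasure_of_dimH_lt hdim)

lemma euclideanHausdorffMeasure_finrank_eq_volume (s : Set E) [Nonempty (affineSpan ℝ s)]
    (p : affineSpan ℝ s) :
    (μHE[Module.finrank ℝ (vectorSpan ℝ s)] : Measure E) s =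
      volume (IsometryEquiv.vaddConst p ⁻¹' ((↑) ⁻¹' s : Set (affineSpan ℝ s))) := by
  rw [(EuclideanGeometry.measurePreserving_vaddConst p).measure_preimage_emb
    (IsometryEquiv.vaddConst p).toHomeomorph.measurableEmbedding,
    ← AffineSubspace.euclideanHausdorffMeasure_coe_image,
    image_preimage_eq_of_subset fun x hx => ⟨⟨x, subset_affineSpan ℝ s hx⟩, rfl⟩]
  rw [direction_affineSpan]

lemma euclideanHausdorffMeasure_finrank_lt_top {s : Set E} (hs : Bornology.IsBounded s) :
    (μHE[Module.finrank ℝ (vectorSpan ℝ s)] : Measure E) s < ⊤ := by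
  rcases s.eq_empty_or_nonempty with rfl | ⟨x, hx⟩
  · simp
  have : Nonempty (affineSpan ℝ s) := ⟨⟨x, subset_affineSpan ℝ s hx⟩⟩
  rw [euclideanHausdorffMeasure_finrank_eq_volume s ⟨x, subset_affineSpan ℝ s hx⟩]
  exact ((IsometryEquiv.vaddConst _).isometry.antilipschitz.isBounded_preimage
    (isometry_subtype_coe.antilipschitz.isBounded_preimage hs)).measure_lt_top

lemma euclideanHausdorffMeasure_finrank_pos {s : Set E} (hs : Convex ℝ s) (hne : s.Nonempty) :
    0 < (μHE[Module.finrank ℝ (vectorSpan ℝ s)] : Measure E) s := by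
  obtain ⟨_, y, hy, -⟩ := hne.intrinsicInterior hs
  have : Nonempty (affineSpan ℝ s) := ⟨y⟩
  rw [euclideanHausdorffMeasure_finrank_eq_volume s y]
  refine Measure.measure_pos_of_nonempty_interior _ ⟨(IsometryEquiv.vaddConst y).symm y, ?_⟩
  rw [← IsometryEquiv.coe_toHomeomorph, ← Homeomorph.preimage_interior, mem_preimage,
    IsometryEquiv.coe_toHomeomorph, IsometryEquiv.apply_symm_apply]
  exact hy

lemma affineMap_eqOn_zero_of_measure_ne_zero {F : Type*} [AddCommGroup F] [Module ℝ F]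
    {s : Set E} (hs : Convex ℝ s) (f : E →ᵃ[ℝ] F)
    (hpos : (μHE[Module.finrank ℝ (vectorSpan ℝ s)] : Measure E) {x ∈ s | f x = 0} ≠ 0) :
    EqOn f 0 s := by
  set N : Set E := {x ∈ s | f x = 0}
  have hN_convex : Convex ℝ N := hs.inter ((convex_singleton (0 : F)).affine_preimage f)
  have hN_sub : N ⊆ s := fun x hx => hx.1
  have hrank : Module.finrank ℝ (vectorSpan ℝ s) ≤ Module.finrank ℝ (vectorSpan ℝ N) :=
    not_lt.1 fun h => hpos (euclideanHausdorffMeasure_eq_zero_of_finrank_lt hN_convex h)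
  have hspan : affineSpan ℝ N = affineSpan ℝ s :=
    AffineSubspace.eq_of_direction_eq_of_nonempty_of_le
      (by simpa only [direction_affineSpan] using
        Submodule.eq_of_le_of_finrank_le (vectorSpan_mono ℝ hN_sub) hrank)
      ((nonempty_of_measure_ne_zero hpos).affineSpan ℝ) (affineSpan_mono ℝ hN_sub)
  have hzero : EqOn f (AffineMap.const ℝ E (0 : F)) (affineSpan ℝ N) :=
    AffineMap.eqOn_affineSpan fun x hx => hx.2
  exact fun x hx => hzero (hspan ▸ subset_affineSpan ℝ s hx)

lemma euclideanHausdorffMeasure_convexHull_eq_zero {s : Finset E} {m : ℕ} (hm : s.card ≤ m) :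
    (μHE[m] : Measure E) (convexHull ℝ s) = 0 := by
  classical
  rcases s.eq_empty_or_nonempty with rfl | hne
  · simp
  refine euclideanHausdorffMeasure_eq_zero_of_finrank_lt (convex_convexHull ℝ _) ?_
  have hrank := finrank_vectorSpan_image_finset_le ℝ id s (Nat.sub_add_cancel hne.card_pos).symm
  rw [Finset.coe_image, image_id] at hrank
  rw [vectorSpan_convexHull]
  have := hne.card_pos
  omega

end HausdorffMeasure

section GenericSegments

variable {E : Type*} [NormedAddCommGroup E] [InnerProductSpace ℝ E] [FiniteDimensional ℝ E]
  [MeasurableSpace E] [BorelSpace E]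

lemma volume_affineSpan_eq_zero {s : Finset E} (hs : s.card ≤ Module.finrank ℝ E) :
    volume (affineSpan ℝ (s : Set E) : Set E) = 0 := by
  classical
  refine Measure.addHaar_affineSubspace _ _ fun htop => ?_
  rcases s.eq_empty_or_nonempty with rfl | hne
  · simp at htop
  · have hrank := finrank_vectorSpan_image_finset_le ℝ id s (Nat.sub_add_cancel hne.card_pos).symm
    rw [Finset.coe_image, image_id, ← direction_affineSpan, htop, AffineSubspace.direction_top,
      finrank_top] at hrank
    have := hne.card_pos
    omega

lemma exists_mem_notMem_of_volume_eq_zero {U N : Set E} (hU : IsOpen U) (hne : U.Nonempty)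
    (hN : volume N = 0) : ∃ y ∈ U, y ∉ N := by
  by_contra! hsub
  exact (hU.measure_pos volume hne).ne' (measure_mono_null hsub hN)

lemma exists_segment_disjoint_convexHull {S : Set (Finset E)} (hS : S.Countable)
    (hcard : ∀ s ∈ S, s.card < Module.finrank ℝ E) {U V : Set E} (hU : IsOpen U)
    (hU_ne : U.Nonempty) (hV : IsOpen V) (hV_ne : V.Nonempty) :
    ∃ y ∈ U, ∃ z ∈ V, ∀ s ∈ S, Disjoint (segment ℝ y z) (convexHull ℝ (s : Set E)) := by
  classical
  obtain ⟨y, hyU, hy⟩ := exists_mem_notMem_of_volume_eq_zero hU hU_ne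
    ((measure_biUnion_null_iff hS).2 fun s hs => volume_affineSpan_eq_zero (hcard s hs).le)
  -- the points that a segment from `y` can reach through one of the simplices
  obtain ⟨z, hzV, hz⟩ := exists_mem_notMem_of_volume_eq_zero hV hV_ne
    ((measure_biUnion_null_iff hS).2 fun s hs => volume_affineSpan_eq_zero
      ((Finset.card_insert_le y s).trans (hcard s hs)))
  refine ⟨y, hyU, z, hzV, fun s hs => Set.disjoint_left.2 fun x hx hxs => hz ?_⟩
  refine mem_biUnion hs ?_
  rw [Finset.coe_insert]
  exact mem_affineSpan_insert_of_mem_segment hx (convexHull_subset_affineSpan _ hxs)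
    fun hys => hy (mem_biUnion hs hys)

end GenericSegments

/-! ### Simplices -/

section Simplices

variable {d : ℕ}

lemma isCompact_hull (T : Finset (Pt d)) : IsCompact (hull T) :=
  T.finite_toSet.isCompact_convexHull ℝ

lemma isClosed_hull (T : Finset (Pt d)) : IsClosed (hull T) := (isCompact_hull T).isClosed

lemma convex_hull (T : Finset (Pt d)) : Convex ℝ (hull T) := convex_convexHull ℝ _

lemma hull_mono {s T : Finset (Pt d)} (h : s ⊆ T) : hull s ⊆ hull T :=
  convexHull_mono (Finset.coe_subset.2 h)

lemma mem_hull_of_mem {T : Finset (Pt d)} {a : Pt d} (h : a ∈ T) : a ∈ hull T :=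
  subset_convexHull ℝ _ (Finset.mem_coe.2 h)

lemma affineMap_eqOn_hull {s : Finset (Pt d)} {f g : Pt d →ᵃ[ℝ] ℝ} (h : ∀ a ∈ s, f a = g a) :
    EqOn f g (hull s) :=
  (AffineMap.eqOn_affineSpan h).mono (convexHull_subset_affineSpan _)

/-- The finite set `T` is the vertex set of a nondegenerate `d`-simplex in dimension `d`. -/
structure IsFullSimplex (T : Finset (Pt d)) : Prop where
  indep : AffineIndependent ℝ ((↑) : T → Pt d)
  card_eq : T.card = d + 1

/-- The vertices of a nondegenerate `d`-simplex as an affine basis. -/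
def IsFullSimplex.basis {T : Finset (Pt d)} (hT : IsFullSimplex T) : AffineBasis T ℝ (Pt d) :=
  ⟨(↑), hT.indep, (hT.indep.affineSpan_eq_top_iff_card_eq_finrank_add_one).2 (by
    simp [hT.card_eq])⟩

open Classical in
/-- The barycentric coordinate of the simplex `T` belonging to the vertex `a`, set to zero when `T`
is degenerate or `a` is not a vertex. -/
def bary (T : Finset (Pt d)) (a : Pt d) : Pt d →ᵃ[ℝ] ℝ :=
  if h : IsFullSimplex T ∧ a ∈ T then h.1.basis.coord ⟨a, h.2⟩ else 0

/-- The relative interior of the facet of the simplex `T` opposite to the vertex `a`. -/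
def openFacet (T : Finset (Pt d)) (a : Pt d) : Set (Pt d) :=
  {x | bary T a x = 0 ∧ ∀ b ∈ T, b ≠ a → 0 < bary T b x}

lemma continuous_bary (T : Finset (Pt d)) (a : Pt d) : Continuous (bary T a) :=
  (bary T a).continuous_of_finiteDimensional

lemma eventually_bary_pos_of_mem_openFacet {T : Finset (Pt d)} {a x : Pt d}
    (hx : x ∈ openFacet T a) : ∀ᶠ y in 𝓝 x, ∀ b ∈ T, b ≠ a → 0 < bary T b y := by
  simp only [Finset.eventually_all, eventually_imp_distrib_left]
  exact fun b hb hba => (continuous_bary T b).continuousAt.eventually_const_lt (hx.2 b hb hba)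

namespace IsFullSimplex

variable {T T' : Finset (Pt d)} {a a' b x : Pt d}

lemma bary_eq_coord (hT : IsFullSimplex T) (ha : a ∈ T) :
    bary T a = hT.basis.coord ⟨a, ha⟩ := by
  simp [bary, hT, ha]

lemma bary_self (hT : IsFullSimplex T) (ha : a ∈ T) : bary T a a = 1 := by
  rw [hT.bary_eq_coord ha]
  exact hT.basis.coord_apply_eq ⟨a, ha⟩

lemma bary_of_ne (hT : IsFullSimplex T) (ha : a ∈ T) (hb : b ∈ T) (hab : a ≠ b) :
    bary T a b = 0 := by
  rw [hT.bary_eq_coord ha]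
  exact hT.basis.coord_apply_ne (i := ⟨a, ha⟩) (j := ⟨b, hb⟩) (by simpa using hab)

lemma sum_bary (hT : IsFullSimplex T) (x : Pt d) : ∑ a ∈ T, bary T a x = 1 := by
  rw [← hT.basis.sum_coord_apply_eq_one x, ← Finset.sum_coe_sort]
  exact Finset.sum_congr rfl fun i _ => by rw [hT.bary_eq_coord i.2]

lemma sum_bary_smul (hT : IsFullSimplex T) (x : Pt d) : ∑ a ∈ T, bary T a x • a = x := by
  conv_rhs => rw [← hT.basis.linear_combination_coord_eq_self x]
  rw [← Finset.sum_coe_sort]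
  exact Finset.sum_congr rfl fun i _ => by rw [hT.bary_eq_coord i.2]; rfl

lemma range_basis (hT : IsFullSimplex T) : range hT.basis = (T : Set (Pt d)) :=
  Subtype.range_coe

lemma affineSpan_eq_top (hT : IsFullSimplex T) : affineSpan ℝ (T : Set (Pt d)) = ⊤ := by
  rw [← hT.range_basis]
  exact hT.basis.tot

lemma mem_hull_iff (hT : IsFullSimplex T) : x ∈ hull T ↔ ∀ a ∈ T, 0 ≤ bary T a x := by
  rw [hull, ← hT.range_basis, hT.basis.convexHull_eq_nonneg_coord]
  simp only [mem_ofPred_eq, Subtype.forall]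
  exact forall₂_congr fun a ha => by rw [hT.bary_eq_coord ha]

lemma mem_interior_hull_iff (hT : IsFullSimplex T) :
    x ∈ interior (hull T) ↔ ∀ a ∈ T, 0 < bary T a x := by
  rw [hull, ← hT.range_basis, hT.basis.interior_convexHull]
  simp only [mem_ofPred_eq, Subtype.forall]
  exact forall₂_congr fun a ha => by rw [hT.bary_eq_coord ha]

lemma bary_centroid_pos (hT : IsFullSimplex T) {s : Finset (Pt d)} (hs : s ⊆ T) (hb : b ∈ s) :
    0 < bary T b (s.centroid ℝ id) := by
  have hsum := s.sum_centroidWeights_eq_one_of_nonempty ℝ ⟨b, hb⟩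
  rw [Finset.centroid_def, Finset.map_affineCombination _ _ _ hsum,
    Finset.affineCombination_eq_linear_combination _ _ _ hsum]
  have hcard : 0 < s.card := Finset.card_pos.2 ⟨b, hb⟩
  refine Finset.sum_pos' (fun c hc => ?_) ⟨b, hb, ?_⟩
  · exact mul_nonneg (by simp) (hT.mem_hull_iff.1 (mem_hull_of_mem (hs hc)) b (hs hb))
  · simp [hT.bary_self (hs hb), hcard]

lemma centroid_mem_interior_hull (hT : IsFullSimplex T) :
    T.centroid ℝ id ∈ interior (hull T) :=
  hT.mem_interior_hull_iff.2 fun _ hb => hT.bary_centroid_pos subset_rfl hb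

lemma closure_interior_hull (hT : IsFullSimplex T) : closure (interior (hull T)) = hull T := by
  rw [(convex_hull T).closure_interior_eq_closure_of_nonempty_interior
    ⟨_, hT.centroid_mem_interior_hull⟩, (isClosed_hull T).closure_eq]

lemma mem_hull_iff_of_subset (hT : IsFullSimplex T) {s : Finset (Pt d)} (hs : s ⊆ T) :
    x ∈ hull s ↔ x ∈ hull T ∧ ∀ a ∈ T, a ∉ s → bary T a x = 0 := by
  constructor
  · refine fun hx => ⟨hull_mono hs hx, fun a ha has => ?_⟩
    exact affineMap_eqOn_hull (g := AffineMap.const ℝ _ 0)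
      (fun b hb => hT.bary_of_ne ha (hs hb) (ne_of_mem_of_not_mem hb has).symm) hx
  · rintro ⟨hx, hzero⟩
    have hsum : ∑ a ∈ s, bary T a x = 1 := by
      rw [← hT.sum_bary x]
      exact Finset.sum_subset hs hzero
    have hcomb : ∑ a ∈ s, bary T a x • a = x := by
      conv_rhs => rw [← hT.sum_bary_smul x]
      exact Finset.sum_subset hs fun a ha has => by simp [hzero a ha has]
    rw [← hcomb]
    exact (convex_hull s).sum_mem (fun a ha => hT.mem_hull_iff.1 hx a (hs ha)) hsum
      fun a ha => mem_hull_of_mem ha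

lemma mem_hull_erase_iff (hT : IsFullSimplex T) (ha : a ∈ T) :
    x ∈ hull (T.erase a) ↔ x ∈ hull T ∧ bary T a x = 0 := by
  rw [hT.mem_hull_iff_of_subset (Finset.erase_subset a T)]
  refine and_congr_right fun _ => ⟨fun h => h a ha (by simp), fun h b hb hbs => ?_⟩
  obtain rfl : b = a := by simpa [hb] using hbs
  exact h

lemma openFacet_subset_hull_erase (hT : IsFullSimplex T) (ha : a ∈ T) :
    openFacet T a ⊆ hull (T.erase a) := by
  refine fun x hx => (hT.mem_hull_erase_iff ha).2 ⟨hT.mem_hull_iff.2 fun b hb => ?_, hx.1⟩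
  rcases eq_or_ne b a with rfl | hba
  · exact hx.1.ge
  · exact (hx.2 b hb hba).le

lemma card_erase (hT : IsFullSimplex T) (ha : a ∈ T) : (T.erase a).card = d := by
  rw [Finset.card_erase_of_mem ha, hT.card_eq, Nat.add_sub_cancel]

lemma centroid_erase_mem_openFacet (hT : IsFullSimplex T) (ha : a ∈ T) (hd : 0 < d) :
    (T.erase a).centroid ℝ id ∈ openFacet T a := by
  have hne : (T.erase a).Nonempty := Finset.card_pos.1 (hd.trans_eq (hT.card_erase ha).symm)
  refine ⟨((hT.mem_hull_erase_iff ha).1 ((T.erase a).centroid_mem_convexHull hne)).2,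
    fun b hb hba => ?_⟩
  exact hT.bary_centroid_pos (Finset.erase_subset a T) (Finset.mem_erase.2 ⟨hba, hb⟩)

lemma exists_erase_eq_erase (hT : IsFullSimplex T) (hT' : IsFullSimplex T') (ha : a ∈ T)
    (hsub : T.erase a ⊆ T') : ∃ a' ∈ T', T'.erase a' = T.erase a := by
  obtain ⟨a', ha', hins⟩ := Finset.exists_eq_insert_iff.2
    ⟨hsub, by rw [hT.card_erase ha, hT'.card_eq]⟩
  exact ⟨a', hins ▸ Finset.mem_insert_self _ _, by rw [← hins, Finset.erase_insert ha']⟩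

lemma bary_eq_mul_bary (hT : IsFullSimplex T) (hT' : IsFullSimplex T') (ha : a ∈ T)
    (ha' : a' ∈ T') (hF : T'.erase a' = T.erase a) (x : Pt d) :
    bary T a x = bary T a a' * bary T' a' x := by
  have heq : bary T a = bary T a a' • bary T' a' := by
    refine AffineMap.ext_on hT'.affineSpan_eq_top fun b hb => ?_
    rcases eq_or_ne b a' with rfl | hba'
    · simp [hT'.bary_self ha']
    · have hbF : b ∈ T.erase a := hF ▸ Finset.mem_erase.2 ⟨hba', hb⟩
      rw [Finset.mem_erase] at hbF
      simp [hT'.bary_of_ne ha' hb hba'.symm, hT.bary_of_ne ha hbF.2 hbF.1.symm]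
  exact congrArg (fun f : Pt d →ᵃ[ℝ] ℝ => f x) heq

lemma openFacet_subset_openFacet (hT : IsFullSimplex T) (hT' : IsFullSimplex T') (ha : a ∈ T)
    (ha' : a' ∈ T') (hF : T'.erase a' = T.erase a) : openFacet T a ⊆ openFacet T' a' := by
  intro x hx
  have hxF := hT.openFacet_subset_hull_erase ha hx
  refine ⟨((hT'.mem_hull_erase_iff ha').1 (hF ▸ hxF)).2, fun b hb hba' => ?_⟩
  have hbF : b ∈ T.erase a := hF ▸ Finset.mem_erase.2 ⟨hba', hb⟩
  have hagree : EqOn (bary T' b) (bary T b) (hull (T.erase a)) := by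
    refine affineMap_eqOn_hull fun c hc => ?_
    have hcT' : c ∈ T' := Finset.mem_of_mem_erase (hF ▸ hc)
    rcases eq_or_ne b c with rfl | hbc
    · rw [hT'.bary_self hb, hT.bary_self (Finset.mem_of_mem_erase hbF)]
    · rw [hT'.bary_of_ne hb hcT' hbc, hT.bary_of_ne (Finset.mem_of_mem_erase hbF)
        (Finset.mem_of_mem_erase hc) hbc]
  rw [hagree hxF]
  exact hx.2 b (Finset.mem_of_mem_erase hbF) (Finset.ne_of_mem_erase hbF)

end IsFullSimplex

end Simplices

/-! ### Combinatorics of triangulations -/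

namespace Triangulation

variable {d : ℕ} {Ω : Set (Pt d)} {𝓣 : Triangulation Ω} {T T' F : Finset (Pt d)} {a a' x : Pt d}

lemma mem_cells_iff : T ∈ 𝓣.cells ↔ T ∈ 𝓣.faces ∧ T.card = d + 1 := by
  simp [cells]

lemma mem_cellsOn_iff : T ∈ 𝓣.cellsOn F ↔ T ∈ 𝓣.cells ∧ F ⊆ T := by
  simp [cellsOn]

lemma mem_interiorFaces_iff :
    F ∈ 𝓣.interiorFaces ↔ F ∈ 𝓣.faces ∧ F.card = d ∧ (𝓣.cellsOn F).card = 2 := by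
  simp [interiorFaces]

lemma mem_boundaryVertices_iff : a ∈ 𝓣.boundaryVertices T ↔
    a ∈ T ∧ T.erase a ∈ 𝓣.faces ∧ (T.erase a).card = d ∧ (𝓣.cellsOn (T.erase a)).card = 1 := by
  rw [boundaryVertices, Finset.mem_filter, boundaryFaces, Finset.mem_filter, Finite.mem_toFinset]

lemma isFullSimplex (hT : T ∈ 𝓣.cells) : IsFullSimplex T :=
  ⟨𝓣.indep (mem_cells_iff.1 hT).1, (mem_cells_iff.1 hT).2⟩

lemma erase_mem_faces (hT : T ∈ 𝓣.cells) (ha : a ∈ T) (hd : 0 < d) : T.erase a ∈ 𝓣.faces :=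
  (𝓣.isRelLowerSet_faces (mem_cells_iff.1 hT).1).2 (Finset.erase_subset _ _)
    (Finset.card_pos.1 (hd.trans_eq ((isFullSimplex hT).card_erase ha).symm))

variable (𝓣) in
lemma closure_eq_iUnion_cells : closure Ω = ⋃ T ∈ 𝓣.cells, hull T := by
  ext x
  rw [← 𝓣.space_eq, Geometry.SimplicialComplex.mem_space_iff]
  simp only [mem_iUnion, exists_prop]
  constructor
  · rintro ⟨s, hs, hx⟩
    obtain ⟨T, hT, hsT, hcard⟩ := 𝓣.pure s hs
    exact ⟨T, mem_cells_iff.2 ⟨hT, hcard⟩, hull_mono hsT hx⟩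
  · rintro ⟨T, hT, hx⟩
    exact ⟨T, (mem_cells_iff.1 hT).1, hx⟩

lemma exists_cell_of_mem_closure (𝓣 : Triangulation Ω) (hx : x ∈ closure Ω) :
    ∃ T ∈ 𝓣.cells, x ∈ hull T := by
  simpa [𝓣.closure_eq_iUnion_cells] using hx

lemma hull_subset_closure (hT : T ∈ 𝓣.cells) : hull T ⊆ closure Ω :=
  𝓣.closure_eq_iUnion_cells ▸ subset_biUnion_of_mem (Finset.mem_coe.2 hT)

lemma interior_hull_subset (hΩ : interior (closure Ω) = Ω) (hT : T ∈ 𝓣.cells) :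
    interior (hull T) ⊆ Ω :=
  (interior_mono (hull_subset_closure hT)).trans_eq hΩ

lemma inter_hull_nonempty (hΩ : interior (closure Ω) = Ω) (hT : T ∈ 𝓣.cells) :
    (Ω ∩ hull T).Nonempty :=
  have h := (isFullSimplex hT).centroid_mem_interior_hull
  ⟨_, interior_hull_subset hΩ hT h, interior_subset h⟩

lemma bary_eq_zero_of_mem_inter (hT : T ∈ 𝓣.cells) (hT' : T' ∈ 𝓣.cells) (hx : x ∈ hull T)
    (hx' : x ∈ hull T') (ha : a ∈ T) (ha' : a ∉ T') : bary T a x = 0 := by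
  classical
  have hmem : x ∈ hull (T ∩ T') := by
    simpa [hull] using
      𝓣.inter_subset_convexHull (mem_cells_iff.1 hT).1 (mem_cells_iff.1 hT').1 ⟨hx, hx'⟩
  exact (((isFullSimplex hT).mem_hull_iff_of_subset Finset.inter_subset_left).1 hmem).2 a ha
    (by simp [ha'])

lemma eq_of_mem_interior_hull (hT : T ∈ 𝓣.cells) (hT' : T' ∈ 𝓣.cells)
    (hx : x ∈ interior (hull T)) (hx' : x ∈ hull T') : T = T' := by
  refine Finset.eq_of_subset_of_card_le (fun b hb => ?_) ?_
  · by_contra hb'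
    exact ((isFullSimplex hT).mem_interior_hull_iff.1 hx b hb).ne'
      (bary_eq_zero_of_mem_inter hT hT' (interior_subset hx) hx' hb hb')
  · rw [(isFullSimplex hT).card_eq, (isFullSimplex hT').card_eq]

variable (𝓣) in
/-- The union of the faces of codimension at least two. -/
def skeleton : Set (Pt d) := ⋃ s ∈ {s ∈ 𝓣.faces | s.card < d}, hull s

lemma mem_openFacet_of_notMem_skeleton (hT : T ∈ 𝓣.cells) (hx : x ∈ hull T)
    (hx_int : x ∉ interior (hull T)) (hx_skel : x ∉ 𝓣.skeleton) : ∃ a ∈ T, x ∈ openFacet T a := by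
  have hTfull := isFullSimplex hT
  have hnonneg := hTfull.mem_hull_iff.1 hx
  obtain ⟨a, ha, ha_le⟩ : ∃ a ∈ T, bary T a x ≤ 0 := by
    simpa [hTfull.mem_interior_hull_iff] using hx_int
  have ha_zero := ha_le.antisymm (hnonneg a ha)
  set s := T.filter fun b => 0 < bary T b x
  have hx_s : x ∈ hull s := (hTfull.mem_hull_iff_of_subset (Finset.filter_subset _ _)).2
    ⟨hx, fun b hb hbs => (hnonneg b hb).eq_of_not_lt' (by simpa [s, hb] using hbs)⟩
  have hs_face : s ∈ 𝓣.faces :=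
    (𝓣.isRelLowerSet_faces (mem_cells_iff.1 hT).1).2 (Finset.filter_subset _ _)
      (Finset.coe_nonempty.1 (convexHull_nonempty_iff.1 ⟨x, hx_s⟩))
  have hs_card : d ≤ s.card := not_lt.1 fun h => hx_skel (mem_biUnion ⟨hs_face, h⟩ hx_s)
  have hs_sub : s ⊆ T.erase a := fun b hb => Finset.mem_erase.2
    ⟨by rintro rfl; exact (Finset.mem_filter.1 hb).2.ne' ha_zero, Finset.mem_of_mem_filter b hb⟩
  have hs_eq : s = T.erase a :=
    Finset.eq_of_subset_of_card_le hs_sub ((hTfull.card_erase ha).trans_le hs_card)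
  refine ⟨a, ha, ha_zero, fun b hb hba => ?_⟩
  have hb_s : b ∈ s := hs_eq ▸ Finset.mem_erase.2 ⟨hba, hb⟩
  exact (Finset.mem_filter.1 hb_s).2

lemma erase_subset_of_mem_openFacet (hT : T ∈ 𝓣.cells) (hT' : T' ∈ 𝓣.cells) (ha : a ∈ T)
    (hx : x ∈ openFacet T a) (hx' : x ∈ hull T') : T.erase a ⊆ T' := by
  intro b hb
  obtain ⟨hba, hb⟩ := Finset.mem_erase.1 hb
  have hxT : x ∈ hull T := hull_mono (Finset.erase_subset a T)
    ((isFullSimplex hT).openFacet_subset_hull_erase ha hx)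
  by_contra hb'
  exact (hx.2 b hb hba).ne' (bary_eq_zero_of_mem_inter hT hT' hxT hx' hb hb')

/-- Otherwise the interiors of the two cells would meet near the centroid of their common facet. -/
lemma bary_opposite_vertex_neg (hT : T ∈ 𝓣.cells) (hT' : T' ∈ 𝓣.cells) (hne : T ≠ T')
    (ha : a ∈ T) (ha' : a' ∈ T') (hF : T'.erase a' = T.erase a) (hd : 0 < d) :
    bary T a a' < 0 := by
  have hTfull := isFullSimplex hT
  have hTfull' := isFullSimplex hT'
  have hscale := hTfull.bary_eq_mul_bary hTfull' ha ha' hF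
  by_contra! hnonneg
  have hpos : 0 < bary T a a' := hnonneg.lt_of_ne fun h => by
    simpa [hTfull.bary_self ha, ← h] using hscale a
  have hm := hTfull.centroid_erase_mem_openFacet ha hd
  have hm_closure : (T.erase a).centroid ℝ id ∈ closure (interior (hull T)) := by
    rw [hTfull.closure_interior_hull]
    exact hull_mono (Finset.erase_subset a T) (hTfull.openFacet_subset_hull_erase ha hm)
  obtain ⟨y, hy_int, hy'⟩ := ((mem_closure_iff_frequently.1 hm_closure).and_eventually
    (eventually_bary_pos_of_mem_openFacet
      (hTfull.openFacet_subset_openFacet hTfull' ha ha' hF hm))).exists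
  refine hne (eq_of_mem_interior_hull hT hT' hy_int (hTfull'.mem_hull_iff.2 fun b hb => ?_))
  rcases eq_or_ne b a' with rfl | hba'
  · have := hTfull.mem_interior_hull_iff.1 hy_int a ha
    rw [hscale y] at this
    exact (pos_of_mul_pos_right this hnonneg).le
  · exact (hy' b hb hba').le

lemma hull_union_hull_mem_nhds (hT : T ∈ 𝓣.cells) (hT' : T' ∈ 𝓣.cells) (hne : T ≠ T')
    (ha : a ∈ T) (ha' : a' ∈ T') (hF : T'.erase a' = T.erase a) (hx : x ∈ openFacet T a)
    (hd : 0 < d) : hull T ∪ hull T' ∈ 𝓝 x := by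
  have hTfull := isFullSimplex hT
  have hTfull' := isFullSimplex hT'
  have hneg := bary_opposite_vertex_neg hT hT' hne ha ha' hF hd
  have hx' := hTfull.openFacet_subset_openFacet hTfull' ha ha' hF hx
  filter_upwards [eventually_bary_pos_of_mem_openFacet hx,
    eventually_bary_pos_of_mem_openFacet hx'] with y hy hy'
  rcases le_or_gt 0 (bary T a y) with hya | hya
  · refine Or.inl (hTfull.mem_hull_iff.2 fun b hb => ?_)
    rcases eq_or_ne b a with rfl | hba
    · exact hya
    · exact (hy b hb hba).le
  · rw [hTfull.bary_eq_mul_bary hTfull' ha ha' hF] at hya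
    refine Or.inr (hTfull'.mem_hull_iff.2 fun b hb => ?_)
    rcases eq_or_ne b a' with rfl | hba
    · exact (pos_of_mul_neg_right hya hneg.le).le
    · exact (hy' b hb hba).le

lemma card_cellsOn_erase_le_two (hT : T ∈ 𝓣.cells) (ha : a ∈ T) (hd : 0 < d) :
    (𝓣.cellsOn (T.erase a)).card ≤ 2 := by
  classical
  by_contra! hcard
  have hmem : T ∈ 𝓣.cellsOn (T.erase a) := mem_cellsOn_iff.2 ⟨hT, Finset.erase_subset _ _⟩
  obtain ⟨T₁, h₁, T₂, h₂, hne⟩ : ∃ T₁ ∈ (𝓣.cellsOn (T.erase a)).erase T,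
      ∃ T₂ ∈ (𝓣.cellsOn (T.erase a)).erase T, T₁ ≠ T₂ := by
    rw [← Finset.one_lt_card, Finset.card_erase_of_mem hmem]
    omega
  simp only [Finset.mem_erase, mem_cellsOn_iff] at h₁ h₂
  obtain ⟨hne₁, hT₁, hsub₁⟩ := h₁
  obtain ⟨hne₂, hT₂, hsub₂⟩ := h₂
  have hTfull := isFullSimplex hT
  obtain ⟨a₁, ha₁, hF₁⟩ := hTfull.exists_erase_eq_erase (isFullSimplex hT₁) ha hsub₁
  obtain ⟨a₂, ha₂, hF₂⟩ := hTfull.exists_erase_eq_erase (isFullSimplex hT₂) ha hsub₂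
  -- `a₁` and `a₂` lie beyond the facet from `a`, and opposite to each other
  have hneg₁ := bary_opposite_vertex_neg hT hT₁ hne₁.symm ha ha₁ hF₁ hd
  have hneg₂ := bary_opposite_vertex_neg hT hT₂ hne₂.symm ha ha₂ hF₂ hd
  have hneg₁₂ := bary_opposite_vertex_neg hT₁ hT₂ hne ha₁ ha₂ (hF₂.trans hF₁.symm) hd
  rw [hTfull.bary_eq_mul_bary (isFullSimplex hT₁) ha ha₁ hF₁ a₂] at hneg₂
  exact (mul_pos_of_neg_of_neg hneg₁ hneg₁₂).not_gt hneg₂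

lemma exists_interiorFace_of_mem_inter (hx_skel : x ∉ 𝓣.skeleton) (hT : T ∈ 𝓣.cells)
    (hT' : T' ∈ 𝓣.cells) (hne : T ≠ T') (hx : x ∈ hull T) (hx' : x ∈ hull T') (hd : 0 < d) :
    ∃ F ∈ 𝓣.interiorFaces, T ∈ 𝓣.cellsOn F ∧ T' ∈ 𝓣.cellsOn F := by
  obtain ⟨a, ha, hxa⟩ := mem_openFacet_of_notMem_skeleton hT hx
    (fun h => hne (eq_of_mem_interior_hull hT hT' h hx')) hx_skel
  have hmem : T ∈ 𝓣.cellsOn (T.erase a) := mem_cellsOn_iff.2 ⟨hT, Finset.erase_subset _ _⟩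
  have hmem' : T' ∈ 𝓣.cellsOn (T.erase a) :=
    mem_cellsOn_iff.2 ⟨hT', erase_subset_of_mem_openFacet hT hT' ha hxa hx'⟩
  refine ⟨T.erase a, mem_interiorFaces_iff.2 ⟨erase_mem_faces hT ha hd,
    (isFullSimplex hT).card_erase ha, le_antisymm (card_cellsOn_erase_le_two hT ha hd) ?_⟩,
    hmem, hmem'⟩
  exact Finset.one_lt_card.2 ⟨T, hmem, T', hmem', hne⟩

lemma exists_boundaryVertex_of_mem_frontier (hΩ : interior (closure Ω) = Ω)
    (hx : x ∈ frontier Ω) (hx_skel : x ∉ 𝓣.skeleton) (hd : 0 < d) :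
    ∃ T ∈ 𝓣.cells, ∃ a ∈ 𝓣.boundaryVertices T, x ∈ hull (T.erase a) := by
  have hΩ_open : IsOpen Ω := hΩ ▸ isOpen_interior
  have hxΩ : x ∉ Ω := fun h => hx.2 (hΩ_open.interior_eq.symm ▸ h)
  obtain ⟨T, hT, hxT⟩ := 𝓣.exists_cell_of_mem_closure hx.1
  have hTfull := isFullSimplex hT
  obtain ⟨a, ha, hxa⟩ := mem_openFacet_of_notMem_skeleton hT hxT
    (fun h => hxΩ (interior_hull_subset hΩ hT h)) hx_skel
  refine ⟨T, hT, a, mem_boundaryVertices_iff.2 ⟨ha, erase_mem_faces hT ha hd,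
    hTfull.card_erase ha, Finset.card_eq_one.2 ⟨T, Finset.eq_singleton_iff_unique_mem.2
      ⟨mem_cellsOn_iff.2 ⟨hT, Finset.erase_subset _ _⟩, fun T' hT' => ?_⟩⟩⟩,
    hTfull.openFacet_subset_hull_erase ha hxa⟩
  obtain ⟨hT', hsub⟩ := mem_cellsOn_iff.1 hT'
  by_contra hne
  obtain ⟨a', ha', hF⟩ := hTfull.exists_erase_eq_erase (isFullSimplex hT') ha hsub
  refine hxΩ (hΩ ▸ mem_interior_iff_mem_nhds.2 (mem_of_superset
    (hull_union_hull_mem_nhds hT hT' (Ne.symm hne) ha ha' hF hxa hd)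
    (union_subset (hull_subset_closure hT) (hull_subset_closure hT'))))

lemma eq_of_isPreconnected {α : Type*} {C : Set (Pt d)} (hC : IsPreconnected C)
    (hCΩ : C ⊆ closure Ω) {φ : Finset (Pt d) → α}
    (hφ : ∀ x ∈ C, ∀ T ∈ 𝓣.cells, ∀ T' ∈ 𝓣.cells, x ∈ hull T → x ∈ hull T' → φ T = φ T')
    (hT : T ∈ 𝓣.cells) (hT' : T' ∈ 𝓣.cells) (hCT : (C ∩ hull T).Nonempty)
    (hCT' : (C ∩ hull T').Nonempty) : φ T = φ T' := by
  classical
  let K (p : α → Prop) : Set (Pt d) := ⋃ S ∈ 𝓣.cells.filter fun S => p (φ S), hull S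
  have hK_closed (p : α → Prop) : IsClosed (K p) :=
    isClosed_biUnion_finset fun S _ => isClosed_hull S
  have hK_iff (p : α → Prop) (x : Pt d) : x ∈ K p ↔ ∃ S ∈ 𝓣.cells, p (φ S) ∧ x ∈ hull S := by
    simp [K, and_assoc]
  clear_value K
  by_contra! hne
  have hcover : C ⊆ K (· = φ T) ∪ K (· ≠ φ T) := fun x hx => by
    obtain ⟨S, hS, hxS⟩ := 𝓣.exists_cell_of_mem_closure (hCΩ hx)
    rcases eq_or_ne (φ S) (φ T) with h | h
    · exact Or.inl ((hK_iff _ x).2 ⟨S, hS, h, hxS⟩)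
    · exact Or.inr ((hK_iff _ x).2 ⟨S, hS, h, hxS⟩)
  have hmeet : (C ∩ K (· = φ T)).Nonempty :=
    hCT.mono fun x hx => ⟨hx.1, (hK_iff _ x).2 ⟨T, hT, rfl, hx.2⟩⟩
  have hmeet' : (C ∩ K (· ≠ φ T)).Nonempty :=
    hCT'.mono fun x hx => ⟨hx.1, (hK_iff _ x).2 ⟨T', hT', hne.symm, hx.2⟩⟩
  obtain ⟨x, hxC, hx_eq, hx_ne⟩ :=
    isPreconnected_closed_iff.1 hC _ _ (hK_closed _) (hK_closed _) hcover hmeet hmeet'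
  obtain ⟨S, hS, hS_eq, hxS⟩ := (hK_iff _ x).1 hx_eq
  obtain ⟨S', hS', hS'_ne, hxS'⟩ := (hK_iff _ x).1 hx_ne
  exact hS'_ne ((hφ x hxC S hS S' hS' hxS hxS').symm.trans hS_eq)

lemma isBounded (𝓣 : Triangulation Ω) : Bornology.IsBounded Ω := by
  refine Bornology.IsBounded.subset ?_ subset_closure
  rw [𝓣.closure_eq_iUnion_cells]
  exact (Bornology.isBounded_biUnion_finset _).2 fun T _ => (isCompact_hull T).isBounded

lemma euclideanHausdorffMeasure_skeleton (𝓣 : Triangulation Ω) : μHE[d - 1] 𝓣.skeleton = 0 :=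
  (measure_biUnion_null_iff (𝓣.finite_faces.subset (sep_subset _ _)).countable).2
    fun _ hs => euclideanHausdorffMeasure_convexHull_eq_zero (Nat.le_sub_one_of_lt hs.2)

lemma exists_segment_disjoint_skeleton {U V : Set (Pt d)} (hU : IsOpen U) (hU_ne : U.Nonempty)
    (hV : IsOpen V) (hV_ne : V.Nonempty) :
    ∃ y ∈ U, ∃ z ∈ V, Disjoint (segment ℝ y z) 𝓣.skeleton := by
  obtain ⟨y, hy, z, hz, hdisj⟩ := exists_segment_disjoint_convexHull
    (S := {s ∈ 𝓣.faces | s.card < d}) (𝓣.finite_faces.subset (sep_subset _ _)).countable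
    (fun s hs => by simpa using hs.2) hU hU_ne hV hV_ne
  exact ⟨y, hy, z, hz, disjoint_iUnion₂_right.2 hdisj⟩

/-- Two cells at a common point of `Ω` are joined by a chain of cells with common interior faces,
namely those crossed by a segment near that point that avoids the skeleton. -/
lemma eq_of_forall_interiorFaces {α : Type*} (hΩ : interior (closure Ω) = Ω)
    (hΩ_conn : IsPreconnected Ω) (hd : 0 < d) {φ : Finset (Pt d) → α}
    (hφ : ∀ F ∈ 𝓣.interiorFaces, ∀ T ∈ 𝓣.cellsOn F, ∀ T' ∈ 𝓣.cellsOn F, φ T = φ T')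
    (hT : T ∈ 𝓣.cells) (hT' : T' ∈ 𝓣.cells) : φ T = φ T' := by
  refine eq_of_isPreconnected hΩ_conn subset_closure (fun x hx S hS S' hS' hxS hxS' => ?_)
    hT hT' (inter_hull_nonempty hΩ hT) (inter_hull_nonempty hΩ hT')
  obtain ⟨r, hr, hball⟩ := Metric.isOpen_iff.1 (hΩ ▸ isOpen_interior : IsOpen Ω) x hx
  have hopen (R : Finset (Pt d)) : IsOpen (Metric.ball x r ∩ interior (hull R)) :=
    Metric.isOpen_ball.inter isOpen_interior
  have hne (R) (hR : R ∈ 𝓣.cells) (hxR : x ∈ hull R) :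
      (Metric.ball x r ∩ interior (hull R)).Nonempty :=
    mem_closure_iff_nhds.1 ((isFullSimplex hR).closure_interior_hull.symm ▸ hxR) _
      (Metric.ball_mem_nhds x hr)
  obtain ⟨y, ⟨hy, hyS⟩, z, ⟨hz, hzS'⟩, hdisj⟩ := 𝓣.exists_segment_disjoint_skeleton
    (hopen S) (hne S hS hxS) (hopen S') (hne S' hS' hxS')
  have hsegΩ : segment ℝ y z ⊆ Ω := ((convex_ball x r).segment_subset hy hz).trans hball
  refine eq_of_isPreconnected (convex_segment y z).isPreconnected (hsegΩ.trans subset_closure)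
    (fun p hp R hR R' hR' hpR hpR' => ?_) hS hS'
    ⟨y, left_mem_segment ℝ y z, interior_subset hyS⟩
    ⟨z, right_mem_segment ℝ y z, interior_subset hzS'⟩
  rcases eq_or_ne R R' with rfl | hRR'
  · rfl
  · obtain ⟨F, hF, hRF, hRF'⟩ := exists_interiorFace_of_mem_inter
      (Set.disjoint_left.1 hdisj hp) hR hR' hRR' hpR hpR' hd
    exact hφ F hF R hRF R' hRF'

end Triangulation

/-! ### Piecewise affine functions -/

section PiecewiseAffine

variable {d : ℕ}

lemma exists_affineMap_eq_eval {σ : Type*} [Fintype σ] {p : MvPolynomial σ ℝ}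
    (hp : p.totalDegree ≤ 1) : ∃ f : EuclideanSpace ℝ σ →ᵃ[ℝ] ℝ,
      ∀ x : EuclideanSpace ℝ σ, MvPolynomial.eval (fun i => x i) p = f x := by
  classical
  have hmonomial : ∀ m ∈ p.support, ∃ f : EuclideanSpace ℝ σ →ᵃ[ℝ] ℝ,
      ∀ x, p.coeff m * ∏ i, x i ^ m i = f x := by
    intro m hm
    have hdeg : m.degree ≤ 1 := (MvPolynomial.le_totalDegree hm).trans hp
    rcases Nat.le_one_iff_eq_zero_or_eq_one.1 hdeg with h | h
    · rw [Finsupp.degree_eq_zero_iff] at h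
      exact ⟨AffineMap.const ℝ _ (p.coeff m), fun x => by simp [h]⟩
    · obtain ⟨i, rfl⟩ := (Finsupp.sum_eq_one_iff m).1 h
      refine ⟨(p.coeff (Finsupp.single i 1) •
        (EuclideanSpace.proj i : EuclideanSpace ℝ σ →L[ℝ] ℝ).toLinearMap).toAffineMap,
        fun x => ?_⟩
      simp [Finsupp.single_apply]
  choose! f hf using hmonomial
  refine ⟨∑ m ∈ p.support, f m, fun x => ?_⟩
  rw [MvPolynomial.eval_eq', Finset.sum_congr rfl fun m hm => hf m hm x]
  induction p.support using Finset.induction_on with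
  | empty => simp
  | insert m s hm ih => simp [Finset.sum_insert hm, ih]

lemma cellTrace_eq_of_eqOn {G : Type} [NormedAddCommGroup G] [NormedSpace ℝ G] [CompleteSpace G]
    {T : Finset (Pt d)} (hT : IsFullSimplex T) {f g : Pt d → G} (hg : ContinuousOn g (hull T))
    (hfg : EqOn f g (interior (hull T))) {x : Pt d} (hx : x ∈ hull T) :
    cellTrace T f x = g x := by
  refine Tendsto.limUnder_eq (Metric.tendsto_nhds.2 fun ε hε => ?_)
  obtain ⟨δ, hδ, hball⟩ := Metric.continuousWithinAt_iff.1 (hg x hx) (ε / 2) (half_pos hε)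
  filter_upwards [Ioo_mem_nhdsGT hδ] with r hr
  have hmeas : MeasurableSet (Metric.ball x r ∩ interior (hull T)) :=
    measurableSet_ball.inter isOpen_interior.measurableSet
  have hpos : volume (Metric.ball x r ∩ interior (hull T)) ≠ 0 := by
    rw [← hT.closure_interior_hull] at hx
    exact ((Metric.isOpen_ball.inter isOpen_interior).measure_pos volume
      (mem_closure_iff_nhds.1 hx _ (Metric.ball_mem_nhds x hr.1))).ne'
  rw [setAverage_congr_fun hmeas (Eventually.of_forall fun y hy => hfg hy.2)]
  have hmem : ⨍ y in Metric.ball x r ∩ interior (hull T), g y ∈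
      Metric.closedBall (g x) (ε / 2) := by
    refine (convex_closedBall _ _).set_average_mem Metric.isClosed_closedBall hpos
      ((measure_mono inter_subset_left).trans_lt measure_ball_lt_top).ne ?_
      ((hg.integrableOn_compact (isCompact_hull T)).mono_set
        (inter_subset_right.trans interior_subset))
    filter_upwards [ae_restrict_mem hmeas] with y hy
    exact (hball (interior_subset hy.2) (lt_trans hy.1 hr.2)).le
  exact lt_of_le_of_lt hmem (half_lt_self hε)

/-- The gradient of `v` at the centroid of `T`; it is the constant gradient of `v` on `T` if `v` is
affine there. -/
def cellGrad (T : Finset (Pt d)) (v : Pt d → ℝ) : Pt d := gradient v (T.centroid ℝ id)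

/-- The first order Taylor polynomial of `v` at the centroid of `T`; it is the affine extension of
`v` from `T` to the whole space if `v` is affine on `T`. -/
def cellAffine (T : Finset (Pt d)) (v : Pt d → ℝ) : Pt d →ᵃ[ℝ] ℝ where
  toFun x := v (T.centroid ℝ id) + inner ℝ (cellGrad T v) (x - T.centroid ℝ id)
  linear := (innerSL ℝ (cellGrad T v)).toLinearMap
  map_vadd' x y := by simp [add_sub_assoc, inner_add_right, add_left_comm]

lemma cellAffine_apply (T : Finset (Pt d)) (v : Pt d → ℝ) (x : Pt d) :
    cellAffine T v x = v (T.centroid ℝ id) + inner ℝ (cellGrad T v) (x - T.centroid ℝ id) :=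
  rfl

lemma cellAffine_sub (T : Finset (Pt d)) (v : Pt d → ℝ) (x y : Pt d) :
    cellAffine T v x - cellAffine T v y = inner ℝ (cellGrad T v) (x - y) := by
  simp only [cellAffine_apply, inner_sub_right]
  ring

lemma continuous_cellAffine (T : Finset (Pt d)) (v : Pt d → ℝ) :
    Continuous (cellAffine T v) :=
  (cellAffine T v).continuous_of_finiteDimensional

lemma hasGradientAt_cellAffine (T : Finset (Pt d)) (v : Pt d → ℝ) (x : Pt d) :
    HasGradientAt (cellAffine T v) (cellGrad T v) x :=
  (((innerSL ℝ (cellGrad T v)).hasFDerivAt.comp x ((hasFDerivAt_id x).sub_const _)).const_add _)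

lemma laplacian_cellAffine (T : Finset (Pt d)) (v : Pt d → ℝ) (x : Pt d) :
    Laplacian.laplacian (cellAffine T v : Pt d → ℝ) x = 0 := by
  have hfderiv : fderiv ℝ (cellAffine T v) = fun _ => innerSL ℝ (cellGrad T v) :=
    funext fun y => (hasGradientAt_cellAffine T v y).hasFDerivAt.fderiv
  simp [InnerProductSpace.laplacian_eq_iteratedFDeriv_stdOrthonormalBasis,
    iteratedFDeriv_two_apply, hfderiv]

lemma eq_cellAffine_of_eventuallyEq {T : Finset (Pt d)} {v : Pt d → ℝ} {f : Pt d →ᵃ[ℝ] ℝ}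
    (h : v =ᶠ[𝓝 (T.centroid ℝ id)] f) : f = cellAffine T v := by
  have hgrad (y : Pt d) : f.linear y = inner ℝ (cellGrad T v) y := by
    have hf : HasFDerivAt f f.linear.toContinuousLinearMap (T.centroid ℝ id) :=
      (⟨f, f.continuous_of_finiteDimensional⟩ : Pt d →ᴬ[ℝ] ℝ).hasFDerivAt
    rw [cellGrad, h.gradient_eq, inner_gradient_left, hf.fderiv]
    rfl
  ext x
  rw [cellAffine_apply, h.eq_of_nhds, ← hgrad, ← vsub_eq_sub x, AffineMap.linearMap_vsub,
    vsub_eq_sub, add_sub_cancel]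

namespace Triangulation

variable {Ω : Set (Pt d)} {𝓣 : Triangulation Ω}

section

variable (hΩ : interior (closure Ω) = Ω) {v : Pt d → ℝ} (hv : v ∈ 𝓣.feSpace 1)
  {T : Finset (Pt d)} (hT : T ∈ 𝓣.cells)

include hΩ hv hT

lemma eqOn_cellAffine : EqOn v (cellAffine T v) (hull T ∩ Ω) := by
  obtain ⟨p, hp, hpv⟩ := hv.2.2 T hT
  obtain ⟨f, hf⟩ := exists_affineMap_eq_eval hp
  have hvf : EqOn v f (hull T ∩ Ω) := fun x hx => (hpv x hx).trans (hf x)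
  have hsub : interior (hull T) ⊆ hull T ∩ Ω :=
    subset_inter interior_subset (interior_hull_subset hΩ hT)
  rwa [← eq_cellAffine_of_eventuallyEq ((hvf.mono hsub).eventuallyEq_of_mem
    (isOpen_interior.mem_nhds (isFullSimplex hT).centroid_mem_interior_hull))]

lemma eventuallyEq_cellAffine {x : Pt d} (hx : x ∈ interior (hull T)) :
    v =ᶠ[𝓝 x] cellAffine T v :=
  (eqOn_cellAffine hΩ hv hT).eventuallyEq_of_mem (mem_of_superset (isOpen_interior.mem_nhds hx)
    (subset_inter interior_subset (interior_hull_subset hΩ hT)))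

lemma gradient_eq_cellGrad {x : Pt d} (hx : x ∈ interior (hull T)) :
    gradient v x = cellGrad T v :=
  (eventuallyEq_cellAffine hΩ hv hT hx).gradient_eq.trans
    (hasGradientAt_cellAffine T v x).gradient

lemma cellTrace_eq_cellAffine {x : Pt d} (hx : x ∈ hull T) :
    cellTrace T v x = cellAffine T v x :=
  cellTrace_eq_of_eqOn (isFullSimplex hT) (continuous_cellAffine T v).continuousOn
    (fun _ hy => (eventuallyEq_cellAffine hΩ hv hT hy).eq_of_nhds) hx

lemma cellTrace_gradient {x : Pt d} (hx : x ∈ hull T) :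
    cellTrace T (gradient v) x = cellGrad T v :=
  cellTrace_eq_of_eqOn (g := fun _ => cellGrad T v) (isFullSimplex hT) continuousOn_const
    (fun _ hy => gradient_eq_cellGrad hΩ hv hT hy) hx

lemma cellTrace_laplacian {x : Pt d} (hx : x ∈ hull T) :
    cellTrace T (Laplacian.laplacian v) x = 0 :=
  cellTrace_eq_of_eqOn (g := fun _ => (0 : ℝ)) (isFullSimplex hT) continuousOn_const
    (fun _ hy => (InnerProductSpace.laplacian_congr_nhds
      (eventuallyEq_cellAffine hΩ hv hT hy)).eq_of_nhds.trans (laplacian_cellAffine T v _)) hx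

lemma normalDeriv_eq_inner {x : Pt d} (hx : x ∈ hull T) (a : Pt d) :
    normalDeriv T a v x = inner ℝ (cellGrad T v) (outerNormal T a x) := by
  rw [normalDeriv, cellTrace_gradient hΩ hv hT hx]

end

section Linearity

variable (hΩ : interior (closure Ω) = Ω) {T : Finset (Pt d)} (hT : T ∈ 𝓣.cells)

include hΩ hT

lemma isLinearMap_cellGrad : IsLinearMap ℝ fun v : 𝓣.feSpace 1 => cellGrad T (v : Pt d → ℝ) := by
  have hgrad (v : 𝓣.feSpace 1) : HasGradientAt v (cellGrad T v) (T.centroid ℝ id) :=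
    (hasGradientAt_cellAffine T v _).congr_of_eventuallyEq
      (eventuallyEq_cellAffine hΩ v.2 hT (isFullSimplex hT).centroid_mem_interior_hull)
  refine ⟨fun v w => HasGradientAt.gradient ?_, fun r v => HasGradientAt.gradient ?_⟩
  · rw [hasGradientAt_iff_hasFDerivAt, map_add]
    exact (hgrad v).hasFDerivAt.add (hgrad w).hasFDerivAt
  · rw [hasGradientAt_iff_hasFDerivAt, map_smul]
    exact (hgrad v).hasFDerivAt.const_smul r

lemma isLinearMap_cellAffine (x : Pt d) :
    IsLinearMap ℝ fun v : 𝓣.feSpace 1 => cellAffine T (v : Pt d → ℝ) x := by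
  simp only [cellAffine_apply]
  exact isLinearMap_add ⟨fun _ _ => rfl, fun _ _ => rfl⟩
    (isLinearMap_inner_left (isLinearMap_cellGrad hΩ hT) _)

end Linearity

lemma finiteDimensional_feSpace (hΩ : interior (closure Ω) = Ω) :
    FiniteDimensional ℝ (𝓣.feSpace 1) := by
  let L : 𝓣.feSpace 1 →ₗ[ℝ] (𝓣.cells → Pt d × ℝ) := LinearMap.pi fun T =>
    ((isLinearMap_cellGrad hΩ T.2).mk' _).prod
      ((isLinearMap_cellAffine hΩ T.2 (T.1.centroid ℝ id)).mk' _)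
  refine FiniteDimensional.of_injective L ((injective_iff_map_eq_zero L).2 fun v hv => ?_)
  ext x
  by_cases hx : x ∈ Ω
  · obtain ⟨T, hT, hxT⟩ := 𝓣.exists_cell_of_mem_closure (subset_closure hx)
    obtain ⟨hgrad, hval⟩ : cellGrad T v = 0 ∧ cellAffine T v (T.centroid ℝ id) = 0 :=
      Prod.mk.inj (congrFun hv ⟨T, hT⟩)
    have hdiff := cellAffine_sub T v x (T.centroid ℝ id)
    rw [hgrad, inner_zero_left, hval, sub_zero] at hdiff
    exact (eqOn_cellAffine hΩ v.2 hT ⟨hxT, hx⟩).trans hdiff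
  · exact v.2.1 x hx

end Triangulation

end PiecewiseAffine

/-! ### The discrete forms -/

namespace Triangulation

variable {d : ℕ} {Ω : Set (Pt d)} {𝓣 : Triangulation Ω}

section Facets

variable {F : Finset (Pt d)}

lemma finrank_vectorSpan_hull (hF : F ∈ 𝓣.faces) (hF_card : F.card = d) :
    Module.finrank ℝ (vectorSpan ℝ (hull F)) = d - 1 :=
  finrank_vectorSpan_convexHull (𝓣.indep hF) (by
    have := Finset.card_pos.2 (𝓣.nonempty_of_mem_faces hF)
    omega)

lemma euclideanHausdorffMeasure_hull_lt_top (hF : F ∈ 𝓣.faces) (hF_card : F.card = d) :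
    μHE[d - 1] (hull F) < ⊤ := by
  rw [← finrank_vectorSpan_hull hF hF_card]
  exact euclideanHausdorffMeasure_finrank_lt_top (isCompact_hull F).isBounded

lemma euclideanHausdorffMeasure_hull_pos (hF : F ∈ 𝓣.faces) (hF_card : F.card = d) :
    0 < μHE[d - 1] (hull F) := by
  obtain ⟨a, ha⟩ := 𝓣.nonempty_of_mem_faces hF
  rw [← finrank_vectorSpan_hull hF hF_card]
  exact euclideanHausdorffMeasure_finrank_pos (convex_hull F) ⟨a, mem_hull_of_mem ha⟩

lemma integrableOn_hull (hF : F ∈ 𝓣.faces) (hF_card : F.card = d) {g : Pt d → ℝ}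
    (hg : ContinuousOn g (hull F)) : IntegrableOn g (hull F) μHE[d - 1] := by
  have hmeas : MeasurableSet (hull F) := (isClosed_hull F).measurableSet
  have : IsFiniteMeasure ((μHE[d - 1] : Measure (Pt d)).restrict (hull F)) :=
    isFiniteMeasure_restrict.2 (euclideanHausdorffMeasure_hull_lt_top hF hF_card).ne
  have hint := hg.integrableOn_compact (μ := (μHE[d - 1] : Measure (Pt d)).restrict (hull F))
    (isCompact_hull F)
  rwa [IntegrableOn, Measure.restrict_restrict hmeas, inter_self] at hint

end Facets

lemma convexHull_diff_singleton (T : Finset (Pt d)) (a : Pt d) :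
    convexHull ℝ ((T : Set (Pt d)) \ {a}) = hull (T.erase a) := by
  rw [hull, Finset.coe_erase]

lemma integrableOn_boundaryFace {T : Finset (Pt d)} {a : Pt d} (ha : a ∈ 𝓣.boundaryVertices T)
    {g : Pt d → ℝ} (hg : ContinuousOn g (hull (T.erase a))) (Γ : Set (Pt d)) :
    IntegrableOn g (convexHull ℝ ((T : Set (Pt d)) \ {a}) ∩ Γ) μHE[d - 1] := by
  obtain ⟨-, hface, hcard, -⟩ := mem_boundaryVertices_iff.1 ha
  rw [convexHull_diff_singleton]
  exact (integrableOn_hull hface hcard hg).mono_set inter_subset_left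

lemma isLinearMap_boundaryIntegral {M : Type*} [AddCommGroup M] [Module ℝ M] {Γ : Set (Pt d)}
    {g : M → Finset (Pt d) → Pt d → Pt d → ℝ}
    (hlin : ∀ T ∈ 𝓣.cells, ∀ a ∈ 𝓣.boundaryVertices T, ∀ x ∈ hull (T.erase a),
      IsLinearMap ℝ fun v => g v T a x)
    (hint : ∀ v, ∀ T ∈ 𝓣.cells, ∀ a ∈ 𝓣.boundaryVertices T,
      IntegrableOn (g v T a) (convexHull ℝ ((T : Set (Pt d)) \ {a}) ∩ Γ) μHE[d - 1]) :
    IsLinearMap ℝ fun v => 𝓣.boundaryIntegral Γ (g v) := by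
  refine isLinearMap_sum fun T hT => isLinearMap_sum fun a ha =>
    isLinearMap_integral ?_ fun v => hint v T hT a ha
  rw [convexHull_diff_singleton]
  exact ae_restrict_of_ae_restrict_of_subset inter_subset_left
    ((ae_restrict_mem (isClosed_hull _).measurableSet).mono (hlin T hT a ha))

lemma outerNormal_eq_outerNormal {T : Finset (Pt d)} {a x y : Pt d} (hx : x ∈ hull (T.erase a))
    (hy : y ∈ hull (T.erase a)) : outerNormal T a x = outerNormal T a y := by
  have hxy : x - y ∈ vectorSpan ℝ ((T : Set (Pt d)) \ {a}) := by
    rw [← vectorSpan_convexHull, convexHull_diff_singleton]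
    exact vsub_mem_vectorSpan ℝ hx hy
  have hproj := Submodule.starProjection_orthogonal_apply_eq_zero hxy
  rw [← sub_sub_sub_cancel_right x y a, map_sub, sub_eq_zero] at hproj
  simp only [outerNormal, hproj]

section Linearity

variable (hΩ : interior (closure Ω) = Ω)

include hΩ

lemma isLinearMap_cellTrace {T : Finset (Pt d)} (hT : T ∈ 𝓣.cells) {x : Pt d} (hx : x ∈ hull T) :
    IsLinearMap ℝ fun v : 𝓣.feSpace 1 => cellTrace T (v : Pt d → ℝ) x := by
  simpa only [fun v : 𝓣.feSpace 1 => cellTrace_eq_cellAffine hΩ v.2 hT hx]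
    using isLinearMap_cellAffine hΩ hT x

lemma isLinearMap_cellTrace_gradient {T : Finset (Pt d)} (hT : T ∈ 𝓣.cells) {x : Pt d}
    (hx : x ∈ hull T) :
    IsLinearMap ℝ fun v : 𝓣.feSpace 1 => cellTrace T (gradient (v : Pt d → ℝ)) x := by
  simpa only [fun v : 𝓣.feSpace 1 => cellTrace_gradient hΩ v.2 hT hx]
    using isLinearMap_cellGrad hΩ hT

lemma isLinearMap_normalDeriv {T : Finset (Pt d)} (hT : T ∈ 𝓣.cells) {x : Pt d}
    (hx : x ∈ hull T) (a : Pt d) :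
    IsLinearMap ℝ fun v : 𝓣.feSpace 1 => normalDeriv T a v x :=
  isLinearMap_inner_left (isLinearMap_cellTrace_gradient hΩ hT hx) _

lemma isLinearMap_gradJumpProd {F : Finset (Pt d)} {x : Pt d} (hx : x ∈ hull F) (u : Pt d → ℝ) :
    IsLinearMap ℝ fun v : 𝓣.feSpace 1 => 𝓣.gradJumpProd F u v x := by
  refine isLinearMap_const_mul _ (isLinearMap_sum fun T hT => isLinearMap_sum fun T' hT' =>
    isLinearMap_inner_right (isLinearMap_sub ?_ ?_) _)
  · obtain ⟨hT_cell, hFT⟩ := mem_cellsOn_iff.1 hT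
    exact isLinearMap_cellTrace_gradient hΩ hT_cell (hull_mono hFT hx)
  · obtain ⟨hT'_cell, hFT'⟩ := mem_cellsOn_iff.1 hT'
    exact isLinearMap_cellTrace_gradient hΩ hT'_cell (hull_mono hFT' hx)

lemma lapJumpProd_eq_zero {F : Finset (Pt d)} (u : Pt d → ℝ) {v : Pt d → ℝ}
    (hv : v ∈ 𝓣.feSpace 1) {x : Pt d} (hx : x ∈ hull F) : 𝓣.lapJumpProd F u v x = 0 := by
  have htrace : ∀ T ∈ 𝓣.cellsOn F, cellTrace T (Laplacian.laplacian v) x = 0 := fun T hT =>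
    cellTrace_laplacian hΩ hv (mem_cellsOn_iff.1 hT).1 (hull_mono (mem_cellsOn_iff.1 hT).2 hx)
  refine mul_eq_zero_of_right _
    (Finset.sum_eq_zero fun T hT => Finset.sum_eq_zero fun T' hT' => ?_)
  rw [htrace T hT, htrace T' hT', sub_zero, mul_zero]

lemma isLinearMap_sCip (γ₁ γ₂ : Finset (Pt d) → ℝ) {Γ : Set (Pt d)} {u : Pt d → ℝ}
    (hu : 𝓣.StabDefined 1 Γ u) :
    IsLinearMap ℝ fun v : 𝓣.feSpace 1 => 𝓣.sCip γ₁ γ₂ u v := by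
  refine isLinearMap_sum fun F hF => isLinearMap_integral ?_ fun v =>
    (((hu v v.2).1 F hF).1.const_mul _).add (((hu v v.2).1 F hF).2.const_mul _)
  filter_upwards [ae_restrict_mem (isClosed_hull F).measurableSet] with x hx
  simp only [fun v : 𝓣.feSpace 1 => lapJumpProd_eq_zero hΩ u v.2 hx, mul_zero, add_zero]
  exact isLinearMap_const_mul _ (isLinearMap_gradJumpProd hΩ hx u)

lemma isLinearMap_sBc {Γ : Set (Pt d)} {u : Pt d → ℝ} (hu : 𝓣.StabDefined 1 Γ u) :
    IsLinearMap ℝ fun v : 𝓣.feSpace 1 => 𝓣.sBc Γ u v := by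
  refine isLinearMap_boundaryIntegral (fun T hT a _ x hx => ?_) fun v T hT a ha =>
    (((hu v v.2).2 T hT a ha).1.const_mul _).add (((hu v v.2).2 T hT a ha).2.const_mul _)
  have hxT : x ∈ hull T := hull_mono (Finset.erase_subset a T) hx
  exact isLinearMap_add
    (isLinearMap_const_mul _ (isLinearMap_const_mul _ (isLinearMap_cellTrace hΩ hT hxT)))
    (isLinearMap_const_mul _ (isLinearMap_const_mul _ (isLinearMap_normalDeriv hΩ hT hxT a)))

lemma isLinearMap_sForm (γ₁ γ₂ : Finset (Pt d) → ℝ) {Γ : Set (Pt d)} {u : Pt d → ℝ}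
    (hu : 𝓣.StabDefined 1 Γ u) :
    IsLinearMap ℝ fun v : 𝓣.feSpace 1 => 𝓣.sForm γ₁ γ₂ Γ u v :=
  isLinearMap_add (isLinearMap_sCip hΩ γ₁ γ₂ hu) (isLinearMap_sBc hΩ hu)

end Linearity

section Integrability

lemma ae_exists_mem_interior_hull (𝓣 : Triangulation Ω) :
    ∀ᵐ x : Pt d, x ∈ closure Ω → ∃ T ∈ 𝓣.cells, x ∈ interior (hull T) := by
  have hfrontier : ∀ᵐ x : Pt d, ∀ T ∈ 𝓣.cells, x ∉ frontier (hull T) :=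
    (ae_ball_iff 𝓣.cells.countable_toSet).2 fun T _ =>
      measure_eq_zero_iff_ae_notMem.1 ((convex_hull T).addHaar_frontier volume)
  filter_upwards [hfrontier] with x hx hxΩ
  obtain ⟨T, hT, hxT⟩ := 𝓣.exists_cell_of_mem_closure hxΩ
  exact ⟨T, hT, by_contra fun h => hx T hT ⟨subset_closure hxT, h⟩⟩

lemma integrableOn_of_forall_cells {g : Pt d → ℝ}
    (hg : ∀ T ∈ 𝓣.cells, IntegrableOn g (interior (hull T))) : IntegrableOn g Ω := by
  refine (integrableOn_finset_iUnion.2 hg).mono_set_ae ?_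
  filter_upwards [𝓣.ae_exists_mem_interior_hull] with x hx hxΩ
  obtain ⟨T, hT, hxT⟩ := hx (subset_closure hxΩ)
  exact mem_biUnion hT hxT

variable (hΩ : interior (closure Ω) = Ω) {v w : Pt d → ℝ} (hv : v ∈ 𝓣.feSpace 1)
  (hw : w ∈ 𝓣.feSpace 1)

include hΩ hv

lemma integrableOn_feSpace : IntegrableOn v Ω := by
  refine integrableOn_of_forall_cells (𝓣 := 𝓣) fun T hT => ?_
  refine IntegrableOn.congr_fun (f := cellAffine T v) ?_
    (fun x hx => ((eventuallyEq_cellAffine hΩ hv hT hx).eq_of_nhds).symm)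
    isOpen_interior.measurableSet
  exact ((continuous_cellAffine T v).continuousOn.integrableOn_compact
    (isCompact_hull T)).mono_set interior_subset

lemma integrableOn_mul_feSpace {f : Pt d → ℝ} (hf : IntegrableOn f Ω) :
    IntegrableOn (fun x => f x * v x) Ω := by
  refine integrableOn_of_forall_cells (𝓣 := 𝓣) fun T hT => ?_
  refine IntegrableOn.congr_fun (f := fun x => f x * cellAffine T v x) ?_ (fun x hx => ?_)
    isOpen_interior.measurableSet
  · exact (hf.mono_set (interior_hull_subset hΩ hT)).mul_continuousOn_of_subset
      (continuous_cellAffine T v).continuousOn isOpen_interior.measurableSet (isCompact_hull T)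
      interior_subset
  · rw [(eventuallyEq_cellAffine hΩ hv hT hx).eq_of_nhds]

lemma continuousOn_cellTrace {T : Finset (Pt d)} (hT : T ∈ 𝓣.cells) :
    ContinuousOn (cellTrace T v) (hull T) :=
  (continuous_cellAffine T v).continuousOn.congr fun _ hx => cellTrace_eq_cellAffine hΩ hv hT hx

lemma continuousOn_normalDeriv {T : Finset (Pt d)} (hT : T ∈ 𝓣.cells) (a : Pt d) :
    ContinuousOn (normalDeriv T a v) (hull (T.erase a)) := by
  have hsub : hull (T.erase a) ⊆ hull T := hull_mono (Finset.erase_subset a T)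
  refine fun x hx => continuousWithinAt_const.congr (fun y hy => ?_) rfl
  rw [normalDeriv_eq_inner hΩ hv hT (hsub hy), normalDeriv_eq_inner hΩ hv hT (hsub hx),
    outerNormal_eq_outerNormal hy hx]

include hw

lemma integrableOn_inner_gradient :
    IntegrableOn (fun x => inner ℝ (gradient v x) (gradient w x)) Ω := by
  refine integrableOn_of_forall_cells (𝓣 := 𝓣) fun T hT => ?_
  refine IntegrableOn.congr_fun (f := fun _ => inner ℝ (cellGrad T v) (cellGrad T w)) ?_
    (fun x hx => ?_) isOpen_interior.measurableSet
  · exact integrableOn_const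
      ((measure_mono interior_subset).trans_lt (isCompact_hull T).measure_lt_top).ne
  · rw [gradient_eq_cellGrad hΩ hv hT hx, gradient_eq_cellGrad hΩ hw hT hx]

lemma gradJumpProd_eq_sum_cellGrad {F : Finset (Pt d)} {x : Pt d} (hx : x ∈ hull F) :
    𝓣.gradJumpProd F v w x = 1 / 2 * ∑ T ∈ 𝓣.cellsOn F, ∑ T' ∈ 𝓣.cellsOn F,
      inner ℝ (cellGrad T v - cellGrad T' v) (cellGrad T w - cellGrad T' w) := by
  have htrace : ∀ T ∈ 𝓣.cellsOn F, ∀ z ∈ 𝓣.feSpace 1,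
      cellTrace T (gradient z) x = cellGrad T z := fun T hT z hz =>
    cellTrace_gradient hΩ hz (mem_cellsOn_iff.1 hT).1 (hull_mono (mem_cellsOn_iff.1 hT).2 hx)
  rw [gradJumpProd]
  congr 1
  refine Finset.sum_congr rfl fun T hT => Finset.sum_congr rfl fun T' hT' => ?_
  rw [htrace T hT v hv, htrace T' hT' v hv, htrace T hT w hw, htrace T' hT' w hw]

omit hw

lemma stabDefined_of_mem_feSpace (Γ : Set (Pt d)) : 𝓣.StabDefined 1 Γ v := by
  refine fun w hw => ⟨fun F hF => ?_, fun T hT a ha => ?_⟩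
  · obtain ⟨hface, hcard, -⟩ := mem_interiorFaces_iff.1 hF
    exact ⟨integrableOn_hull hface hcard (continuousOn_const.congr fun x hx =>
        gradJumpProd_eq_sum_cellGrad hΩ hv hw hx),
      integrableOn_hull hface hcard (continuousOn_const.congr fun x hx =>
        lapJumpProd_eq_zero hΩ v hw hx)⟩
  · have hsub : hull (T.erase a) ⊆ hull T := hull_mono (Finset.erase_subset a T)
    exact ⟨integrableOn_boundaryFace ha (((continuousOn_cellTrace hΩ hv hT).mul
        (continuousOn_cellTrace hΩ hw hT)).mono hsub) Γ,
      integrableOn_boundaryFace ha ((continuousOn_normalDeriv hΩ hv hT a).mul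
        (continuousOn_normalDeriv hΩ hw hT a)) Γ⟩

end Integrability

section Bilinearity

lemma sForm_comm (𝓣 : Triangulation Ω) (γ₁ γ₂ : Finset (Pt d) → ℝ) (Γ : Set (Pt d))
    (u v : Pt d → ℝ) : 𝓣.sForm γ₁ γ₂ Γ u v = 𝓣.sForm γ₁ γ₂ Γ v u := by
  simp only [sForm, sCip, sBc, gradJumpProd, lapJumpProd]
  congr 1
  · simp only [real_inner_comm, mul_comm]
  · simp only [mul_comm]

lemma aForm_comm (𝓣 : Triangulation Ω) (κ : ℝ) (ΓV ΓW : Set (Pt d)) (u v : Pt d → ℝ) :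
    𝓣.aForm κ ΓV ΓW u v = 𝓣.aForm κ ΓW ΓV v u := by
  simp only [aForm, real_inner_comm, mul_comm (u _)]
  ring

variable (hΩ : interior (closure Ω) = Ω)

include hΩ

lemma isLinearMap_integral_inner_gradient {u : Pt d → ℝ} (hu : u ∈ 𝓣.feSpace 1) :
    IsLinearMap ℝ fun v : 𝓣.feSpace 1 =>
      ∫ x in Ω, inner ℝ (gradient u x) (gradient (v : Pt d → ℝ) x) := by
  have hmeas : MeasurableSet Ω := (hΩ ▸ isOpen_interior : IsOpen Ω).measurableSet
  refine isLinearMap_integral ?_ fun v => integrableOn_inner_gradient hΩ hu v.2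
  filter_upwards [ae_restrict_of_ae 𝓣.ae_exists_mem_interior_hull, ae_restrict_mem hmeas]
    with x hx hxΩ
  obtain ⟨T, hT, hxT⟩ := hx (subset_closure hxΩ)
  simp only [fun v : 𝓣.feSpace 1 => gradient_eq_cellGrad hΩ v.2 hT hxT]
  exact isLinearMap_inner_right (isLinearMap_cellGrad hΩ hT) _

lemma isLinearMap_integral_mul {f : Pt d → ℝ} (hf : IntegrableOn f Ω) :
    IsLinearMap ℝ fun v : 𝓣.feSpace 1 => ∫ x in Ω, f x * (v : Pt d → ℝ) x :=
  isLinearMap_integral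
    (Eventually.of_forall fun x => isLinearMap_const_mul (f x) ⟨fun _ _ => rfl, fun _ _ => rfl⟩)
    fun v => integrableOn_mul_feSpace hΩ v.2 hf

lemma isLinearMap_aForm (κ : ℝ) (ΓV ΓW : Set (Pt d)) {u : Pt d → ℝ} (hu : u ∈ 𝓣.feSpace 1) :
    IsLinearMap ℝ fun v : 𝓣.feSpace 1 => 𝓣.aForm κ ΓV ΓW u v := by
  have hsub (T : Finset (Pt d)) (a : Pt d) : hull (T.erase a) ⊆ hull T :=
    hull_mono (Finset.erase_subset a T)
  refine isLinearMap_sub (isLinearMap_sub (isLinearMap_add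
    (isLinearMap_integral_inner_gradient hΩ hu)
    (isLinearMap_const_mul κ (isLinearMap_integral_mul hΩ (integrableOn_feSpace hΩ hu))))
    (isLinearMap_boundaryIntegral (fun T hT a _ x hx => ?_) fun v T hT a ha => ?_))
    (isLinearMap_boundaryIntegral (fun T hT a _ x hx => ?_) fun v T hT a ha => ?_)
  · simpa only [mul_comm] using
      isLinearMap_const_mul (cellTrace T u x) (isLinearMap_normalDeriv hΩ hT (hsub T a hx) a)
  · exact integrableOn_boundaryFace ha ((continuousOn_normalDeriv hΩ v.2 hT a).mul
      ((continuousOn_cellTrace hΩ hu hT).mono (hsub T a))) ΓV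
  · exact isLinearMap_const_mul _ (isLinearMap_cellTrace hΩ hT (hsub T a hx))
  · exact integrableOn_boundaryFace ha ((continuousOn_normalDeriv hΩ hu hT a).mul
      ((continuousOn_cellTrace hΩ v.2 hT).mono (hsub T a))) ΓW

lemma isBilinearMap_aForm (κ : ℝ) (ΓV ΓW : Set (Pt d)) :
    IsBilinearMap ℝ fun v w : 𝓣.feSpace 1 => 𝓣.aForm κ ΓV ΓW v w :=
  isBilinearMap_of_isLinearMap
    (fun w => by simpa only [aForm_comm 𝓣 κ ΓV ΓW] using isLinearMap_aForm hΩ κ ΓW ΓV w.2)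
    fun v => isLinearMap_aForm hΩ κ ΓV ΓW v.2

lemma isBilinearMap_sForm (γ₁ γ₂ : Finset (Pt d) → ℝ) (Γ : Set (Pt d)) :
    IsBilinearMap ℝ fun v w : 𝓣.feSpace 1 => 𝓣.sForm γ₁ γ₂ Γ v w := by
  have hright (v : 𝓣.feSpace 1) : IsLinearMap ℝ fun w : 𝓣.feSpace 1 => 𝓣.sForm γ₁ γ₂ Γ v w :=
    isLinearMap_sForm hΩ γ₁ γ₂ (stabDefined_of_mem_feSpace hΩ v.2 Γ)
  refine isBilinearMap_of_isLinearMap (fun w => ?_) hright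
  simpa only [sForm_comm 𝓣 γ₁ γ₂ Γ] using hright w

end Bilinearity

end Triangulation

/-! ### Definiteness of the stabilisation -/

namespace Triangulation

variable {d : ℕ} {Ω : Set (Pt d)} {𝓣 : Triangulation Ω} {T : Finset (Pt d)} {v : Pt d → ℝ}

section Definiteness

lemma diam_hull_pos {s : Finset (Pt d)} (hs : 1 < s.card) : 0 < Metric.diam (hull s) := by
  obtain ⟨a, ha, b, hb, hab⟩ := Finset.one_lt_card.1 hs
  exact (dist_pos.2 hab).trans_le (Metric.dist_le_diam_of_mem (isCompact_hull s).isBounded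
    (mem_hull_of_mem ha) (mem_hull_of_mem hb))

lemma meshSize_nonneg (𝓣 : Triangulation Ω) : 0 ≤ 𝓣.meshSize :=
  Real.sSup_nonneg (forall_mem_image.2 fun _ _ => Metric.diam_nonneg)

lemma meshSize_pos (hT : T ∈ 𝓣.cells) (hd : 0 < d) : 0 < 𝓣.meshSize := by
  have hcard := (isFullSimplex hT).card_eq
  exact (diam_hull_pos (by omega)).trans_le
    (le_csSup (𝓣.cells.finite_toSet.image _).bddAbove ⟨T, hT, rfl⟩)

lemma sCip_self (hΩ : interior (closure Ω) = Ω) (γ₁ γ₂ : Finset (Pt d) → ℝ)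
    (hv : v ∈ 𝓣.feSpace 1) :
    𝓣.sCip γ₁ γ₂ v v = ∑ F ∈ 𝓣.interiorFaces, (μHE[d - 1] : Measure (Pt d)).real (hull F) *
      (Metric.diam (hull F) * γ₁ F * (1 / 2 * ∑ T ∈ 𝓣.cellsOn F, ∑ T' ∈ 𝓣.cellsOn F,
        ‖cellGrad T v - cellGrad T' v‖ ^ 2)) := by
  refine Finset.sum_congr rfl fun F _ => ?_
  rw [← smul_eq_mul (Measure.real _ _), ← setIntegral_const]
  refine setIntegral_congr_fun (isClosed_hull F).measurableSet fun x hx => ?_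
  simp only [gradJumpProd_eq_sum_cellGrad hΩ hv hv hx, lapJumpProd_eq_zero hΩ v hv hx, mul_zero,
    add_zero, real_inner_self_eq_norm_sq]

lemma sCip_self_summand_nonneg {F : Finset (Pt d)} {c : ℝ} (hc : 0 ≤ c) :
    0 ≤ (μHE[d - 1] : Measure (Pt d)).real (hull F) *
      (Metric.diam (hull F) * c * (1 / 2 * ∑ T ∈ 𝓣.cellsOn F, ∑ T' ∈ 𝓣.cellsOn F,
        ‖cellGrad T v - cellGrad T' v‖ ^ 2)) := by
  have := Metric.diam_nonneg (s := hull F)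
  positivity

lemma sCip_self_nonneg (hΩ : interior (closure Ω) = Ω) {γ₁ : Finset (Pt d) → ℝ}
    (hγ₁ : ∀ F ∈ 𝓣.interiorFaces, 0 ≤ γ₁ F) (γ₂ : Finset (Pt d) → ℝ) (hv : v ∈ 𝓣.feSpace 1) :
    0 ≤ 𝓣.sCip γ₁ γ₂ v v := by
  rw [sCip_self hΩ γ₁ γ₂ hv]
  exact Finset.sum_nonneg fun F hF => sCip_self_summand_nonneg (hγ₁ F hF)

lemma cellGrad_eq_of_sCip_self_eq_zero (hd : 2 ≤ d) (hΩ : interior (closure Ω) = Ω)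
    {γ₁ γ₂ : Finset (Pt d) → ℝ} (hγ₁ : ∀ F ∈ 𝓣.interiorFaces, 0 < γ₁ F)
    (hv : v ∈ 𝓣.feSpace 1) (h : 𝓣.sCip γ₁ γ₂ v v = 0) {F : Finset (Pt d)}
    (hF : F ∈ 𝓣.interiorFaces) {T' : Finset (Pt d)} (hT : T ∈ 𝓣.cellsOn F)
    (hT' : T' ∈ 𝓣.cellsOn F) : cellGrad T v = cellGrad T' v := by
  obtain ⟨hface, hcard, -⟩ := mem_interiorFaces_iff.1 hF
  rw [sCip_self hΩ γ₁ γ₂ hv, Finset.sum_eq_zero_iff_of_nonneg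
    fun F hF => sCip_self_summand_nonneg (hγ₁ F hF).le] at h
  have hμ : (μHE[d - 1] : Measure (Pt d)).real (hull F) ≠ 0 := ENNReal.toReal_ne_zero.2
    ⟨(euclideanHausdorffMeasure_hull_pos hface hcard).ne',
      (euclideanHausdorffMeasure_hull_lt_top hface hcard).ne⟩
  have hdiam : Metric.diam (hull F) ≠ 0 := (diam_hull_pos (by omega)).ne'
  have hjumps : ∑ S ∈ 𝓣.cellsOn F, ∑ S' ∈ 𝓣.cellsOn F, ‖cellGrad S v - cellGrad S' v‖ ^ 2 = 0 := by
    simpa [hμ, hdiam, (hγ₁ F hF).ne'] using h F hF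
  rw [Finset.sum_eq_zero_iff_of_nonneg fun S _ => Finset.sum_nonneg fun S' _ => by positivity]
    at hjumps
  have hjump := (Finset.sum_eq_zero_iff_of_nonneg fun S' _ => by positivity).1 (hjumps T hT) T' hT'
  rwa [sq_eq_zero_iff, norm_eq_zero, sub_eq_zero] at hjump

lemma sBc_self_summand_nonneg (𝓣 : Triangulation Ω) (Γ : Set (Pt d)) (v : Pt d → ℝ)
    (T : Finset (Pt d)) (a : Pt d) :
    0 ≤ ∫ x in convexHull ℝ ((T : Set (Pt d)) \ {a}) ∩ Γ,
      (𝓣.meshSize⁻¹ * (cellTrace T v x * cellTrace T v x)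
        + 𝓣.meshSize * (normalDeriv T a v x * normalDeriv T a v x)) ∂μHE[d - 1] :=
  integral_nonneg fun _ => add_nonneg
    (mul_nonneg (inv_nonneg.2 𝓣.meshSize_nonneg) (mul_self_nonneg _))
    (mul_nonneg 𝓣.meshSize_nonneg (mul_self_nonneg _))

lemma sBc_self_nonneg (𝓣 : Triangulation Ω) (Γ : Set (Pt d)) (v : Pt d → ℝ) :
    0 ≤ 𝓣.sBc Γ v v :=
  Finset.sum_nonneg fun T _ => Finset.sum_nonneg fun a _ => 𝓣.sBc_self_summand_nonneg Γ v T a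

lemma ae_eq_zero_of_sBc_self_eq_zero (hd : 0 < d) (hΩ : interior (closure Ω) = Ω)
    (hv : v ∈ 𝓣.feSpace 1) {Γ : Set (Pt d)} (h : 𝓣.sBc Γ v v = 0) (hT : T ∈ 𝓣.cells) {a : Pt d}
    (ha : a ∈ 𝓣.boundaryVertices T) :
    ∀ᵐ x ∂(μHE[d - 1] : Measure (Pt d)).restrict (hull (T.erase a) ∩ Γ),
      cellTrace T v x = 0 ∧ normalDeriv T a v x = 0 := by
  have hh := meshSize_pos hT hd
  have hcell := (Finset.sum_eq_zero_iff_of_nonneg fun T _ => Finset.sum_nonneg fun a _ =>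
    𝓣.sBc_self_summand_nonneg Γ v T a).1 h T hT
  have hface := (Finset.sum_eq_zero_iff_of_nonneg fun a _ =>
    𝓣.sBc_self_summand_nonneg Γ v T a).1 hcell a ha
  obtain ⟨hint_trace, hint_deriv⟩ := (stabDefined_of_mem_feSpace hΩ hv Γ v hv).2 T hT a ha
  have htrace (x) : 0 ≤ 𝓣.meshSize⁻¹ * (cellTrace T v x * cellTrace T v x) :=
    mul_nonneg (inv_nonneg.2 hh.le) (mul_self_nonneg _)
  have hderiv (x) : 0 ≤ 𝓣.meshSize * (normalDeriv T a v x * normalDeriv T a v x) :=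
    mul_nonneg hh.le (mul_self_nonneg _)
  have hae := (integral_eq_zero_iff_of_nonneg (fun x => add_nonneg (htrace x) (hderiv x))
    ((hint_trace.const_mul _).add (hint_deriv.const_mul _))).1 hface
  rw [convexHull_diff_singleton] at hae
  filter_upwards [hae] with x hx
  have hsum := (add_eq_zero_iff_of_nonneg (htrace x) (hderiv x)).1 hx
  simpa [hh.ne'] using hsum

lemma exists_boundaryVertex_measure_ne_zero (𝓣 : Triangulation Ω) (hd : 0 < d)
    (hΩ : interior (closure Ω) = Ω) {Γ : Set (Pt d)} (hΓ : Γ ⊆ frontier Ω)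
    (hpos : 0 < (μHE[d - 1] : Measure (Pt d)) Γ) :
    ∃ T ∈ 𝓣.cells, ∃ a ∈ 𝓣.boundaryVertices T,
      (μHE[d - 1] : Measure (Pt d)) (hull (T.erase a) ∩ Γ) ≠ 0 := by
  by_contra! hnull
  have hcover : Γ ⊆ 𝓣.skeleton ∪
      ⋃ T ∈ 𝓣.cells, ⋃ a ∈ 𝓣.boundaryVertices T, hull (T.erase a) ∩ Γ := by
    intro x hx
    by_cases hx_skel : x ∈ 𝓣.skeleton
    · exact Or.inl hx_skel
    · obtain ⟨T, hT, a, ha, hxa⟩ := exists_boundaryVertex_of_mem_frontier hΩ (hΓ hx) hx_skel hd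
      exact Or.inr (mem_biUnion hT (mem_biUnion ha ⟨hxa, hx⟩))
  refine hpos.ne' (measure_mono_null hcover
    (measure_union_null 𝓣.euclideanHausdorffMeasure_skeleton ?_))
  exact (measure_biUnion_null_iff 𝓣.cells.countable_toSet).2 fun T hT =>
    (measure_biUnion_null_iff (Finset.countable_toSet _)).2 fun a ha => hnull T hT a ha

lemma inner_sub_eq_zero_of_inner_outerNormal_eq_zero {g a x : Pt d}
    (hg : g ∈ (vectorSpan ℝ ((T : Set (Pt d)) \ {a}))ᗮ)
    (hn : inner ℝ g (outerNormal T a x) = 0) : inner ℝ g (x - a) = 0 := by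
  rw [← Submodule.starProjection_eq_self_iff.2 hg,
    Submodule.inner_starProjection_left_eq_right]
  rw [outerNormal, real_inner_smul_right, mul_eq_zero, inv_eq_zero, norm_eq_zero] at hn
  rcases hn with h | h
  · rw [h, inner_zero_right]
  · exact h

lemma cellAffine_eq_zero_of_eqOn_hull_erase (hT : IsFullSimplex T) {a x : Pt d}
    (hx : x ∈ hull (T.erase a)) (h : EqOn (cellAffine T v) 0 (hull (T.erase a)))
    (hn : inner ℝ (cellGrad T v) (outerNormal T a x) = 0) : cellAffine T v = 0 := by
  have hperp : cellGrad T v ∈ (vectorSpan ℝ ((T : Set (Pt d)) \ {a}))ᗮ := by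
    have hle : vectorSpan ℝ ((T : Set (Pt d)) \ {a}) ≤ (innerₛₗ ℝ (cellGrad T v)).ker := by
      rw [vectorSpan_def, Submodule.span_le]
      rintro - ⟨y, hy, z, hz, rfl⟩
      rw [← Finset.coe_erase] at hy hz
      simp [← cellAffine_sub, h (mem_hull_of_mem hy), h (mem_hull_of_mem hz)]
    exact (Submodule.mem_orthogonal' _ _).2 fun y hy => hle hy
  have hvertex : cellAffine T v a = 0 := by
    have hsub := cellAffine_sub T v x a
    rw [inner_sub_eq_zero_of_inner_outerNormal_eq_zero hperp hn, h hx] at hsub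
    simpa using hsub
  refine AffineMap.ext_on hT.affineSpan_eq_top fun b hb => ?_
  rcases eq_or_ne b a with rfl | hba
  · exact hvertex
  · exact h (mem_hull_of_mem (Finset.mem_erase.2 ⟨hba, hb⟩))

lemma exists_cellAffine_eq_zero_of_sBc_self_eq_zero (hd : 0 < d)
    (hΩ : interior (closure Ω) = Ω) (hv : v ∈ 𝓣.feSpace 1) {Γ : Set (Pt d)}
    (hΓ : Γ ⊆ frontier Ω) (hpos : 0 < (μHE[d - 1] : Measure (Pt d)) Γ)
    (h : 𝓣.sBc Γ v v = 0) : ∃ T ∈ 𝓣.cells, cellAffine T v = 0 := by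
  obtain ⟨T, hT, a, ha, hμ⟩ := 𝓣.exists_boundaryVertex_measure_ne_zero hd hΩ hΓ hpos
  obtain ⟨-, hface, hcard, -⟩ := mem_boundaryVertices_iff.1 ha
  set μ : Measure (Pt d) := μHE[d - 1]
  have hvanish : ∀ᵐ x ∂μ.restrict (hull (T.erase a) ∩ Γ), x ∈ hull (T.erase a) ∧
      cellAffine T v x = 0 ∧ inner ℝ (cellGrad T v) (outerNormal T a x) = 0 := by
    filter_upwards [ae_eq_zero_of_sBc_self_eq_zero hd hΩ hv h hT ha,
      ae_restrict_of_ae_restrict_of_subset inter_subset_left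
        (ae_restrict_mem (isClosed_hull (T.erase a)).measurableSet)] with x ⟨hx_val, hx_deriv⟩ hx
    have hxT := hull_mono (Finset.erase_subset a T) hx
    exact ⟨hx, cellTrace_eq_cellAffine hΩ hv hT hxT ▸ hx_val,
      normalDeriv_eq_inner hΩ hv hT hxT a ▸ hx_deriv⟩
  have : (ae (μ.restrict (hull (T.erase a) ∩ Γ))).NeBot :=
    ae_neBot.2 (mt Measure.restrict_eq_zero.1 hμ)
  have hzero_set : μ {x ∈ hull (T.erase a) | cellAffine T v x = 0} ≠ 0 := by
    intro hnull
    obtain ⟨x, hx, hx_notMem⟩ := (hvanish.and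
      (ae_restrict_of_ae (measure_eq_zero_iff_ae_notMem.1 hnull))).exists
    exact hx_notMem ⟨hx.1, hx.2.1⟩
  obtain ⟨x, hx, -, hxn⟩ := hvanish.exists
  refine ⟨T, hT, cellAffine_eq_zero_of_eqOn_hull_erase (isFullSimplex hT) hx ?_ hxn⟩
  refine affineMap_eqOn_zero_of_measure_ne_zero (convex_hull _) (cellAffine T v) ?_
  rwa [finrank_vectorSpan_hull hface hcard]

lemma cellAffine_eq_cellAffine (hΩ : interior (closure Ω) = Ω) (hΩ_conn : IsPreconnected Ω)
    (hv : v ∈ 𝓣.feSpace 1)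
    (hgrad : ∀ T ∈ 𝓣.cells, ∀ T' ∈ 𝓣.cells, cellGrad T v = cellGrad T' v) {T' : Finset (Pt d)}
    (hT : T ∈ 𝓣.cells) (hT' : T' ∈ 𝓣.cells) : cellAffine T v = cellAffine T' v := by
  refine eq_of_isPreconnected hΩ_conn subset_closure (φ := fun S => cellAffine S v)
    (fun x hx S hS S' hS' hxS hxS' => ?_) hT hT'
    (inter_hull_nonempty hΩ hT) (inter_hull_nonempty hΩ hT')
  have hval : cellAffine S v x = cellAffine S' v x :=
    (eqOn_cellAffine hΩ hv hS ⟨hxS, hx⟩).symm.trans (eqOn_cellAffine hΩ hv hS' ⟨hxS', hx⟩)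
  ext y
  rw [← sub_add_cancel (cellAffine S v y) (cellAffine S v x), cellAffine_sub, hgrad S hS S' hS',
    ← cellAffine_sub, hval, sub_add_cancel]

lemma eq_zero_of_sCip_self_eq_zero_of_sBc_self_eq_zero (hd : 2 ≤ d)
    (hΩ : interior (closure Ω) = Ω) (hΩ_conn : IsPreconnected Ω) {γ₁ γ₂ : Finset (Pt d) → ℝ}
    (hγ₁ : ∀ F ∈ 𝓣.interiorFaces, 0 < γ₁ F) {Γ : Set (Pt d)} (hΓ : Γ ⊆ frontier Ω)
    (hpos : 0 < (μHE[d - 1] : Measure (Pt d)) Γ) (hv : v ∈ 𝓣.feSpace 1)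
    (hcip : 𝓣.sCip γ₁ γ₂ v v = 0) (hbc : 𝓣.sBc Γ v v = 0) : v = 0 := by
  have hd_pos : 0 < d := by omega
  have hgrad : ∀ T ∈ 𝓣.cells, ∀ T' ∈ 𝓣.cells, cellGrad T v = cellGrad T' v :=
    fun T hT T' hT' => eq_of_forall_interiorFaces hΩ hΩ_conn hd_pos (φ := fun T => cellGrad T v)
      (fun F hF S hS S' hS' =>
        cellGrad_eq_of_sCip_self_eq_zero hd hΩ hγ₁ hv hcip hF hS hS') hT hT'
  obtain ⟨T₀, hT₀, hzero⟩ :=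
    exists_cellAffine_eq_zero_of_sBc_self_eq_zero hd_pos hΩ hv hΓ hpos hbc
  ext x
  by_cases hx : x ∈ Ω
  · obtain ⟨T, hT, hxT⟩ := 𝓣.exists_cell_of_mem_closure (subset_closure hx)
    rw [eqOn_cellAffine hΩ hv hT ⟨hxT, hx⟩,
      cellAffine_eq_cellAffine hΩ hΩ_conn hv hgrad hT hT₀, hzero]
    rfl
  · exact hv.1 x hx

lemma sForm_self_pos (hd : 2 ≤ d) (hΩ : interior (closure Ω) = Ω) (hΩ_conn : IsPreconnected Ω)
    {γ₁ : Finset (Pt d) → ℝ} (hγ₁ : ∀ F ∈ 𝓣.interiorFaces, 0 < γ₁ F)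
    (γ₂ : Finset (Pt d) → ℝ) {Γ : Set (Pt d)} (hΓ : Γ ⊆ frontier Ω)
    (hpos : 0 < (μHE[d - 1] : Measure (Pt d)) Γ) (hv : v ∈ 𝓣.feSpace 1) (hv_ne : v ≠ 0) :
    0 < 𝓣.sForm γ₁ γ₂ Γ v v := by
  have hcip := sCip_self_nonneg hΩ (fun F hF => (hγ₁ F hF).le) γ₂ hv
  have hbc := 𝓣.sBc_self_nonneg Γ v
  refine (add_nonneg hcip hbc).lt_of_ne' fun h => hv_ne ?_
  obtain ⟨hcip_zero, hbc_zero⟩ := (add_eq_zero_iff_of_nonneg hcip hbc).1 h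
  exact eq_zero_of_sCip_self_eq_zero_of_sBc_self_eq_zero hd hΩ hΩ_conn hγ₁ hΓ hpos hv
    hcip_zero hbc_zero

end Definiteness

end Triangulation

end

end CauchyFEM

open CauchyFEM CauchyFEM.Triangulation

theorem mainTheorem10_general {d : ℕ} (hd : 2 ≤ d) {Ω : Set (Pt d)}
    (hΩ_conn : IsPreconnected Ω) (hΩ_reg : interior (closure Ω) = Ω) (𝓣 : Triangulation Ω)
    {ΓV ΓW : Set (Pt d)} (hΓV : ΓV ⊆ frontier Ω) (hΓW : ΓW ⊆ frontier Ω)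
    (hΓV_pos : 0 < (μHE[d - 1] : Measure (Pt d)) ΓV)
    (hΓW_pos : 0 < (μHE[d - 1] : Measure (Pt d)) ΓW)
    (κ : ℝ) {γ₁ : Finset (Pt d) → ℝ} (hγ₁ : ∀ F ∈ 𝓣.interiorFaces, 0 < γ₁ F)
    (γ₂ : Finset (Pt d) → ℝ) {f : Pt d → ℝ} (hf : IntegrableOn f Ω)
    {u : Pt d → ℝ} (hu : 𝓣.StabDefined 1 ΓV u) :
    ∃! p : 𝓣.feSpace 1 × 𝓣.feSpace 1, 𝓣.IsFEMSolution 1 κ γ₁ γ₂ ΓV ΓW f u p.1 p.2 := by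
  have : FiniteDimensional ℝ (𝓣.feSpace 1) := finiteDimensional_feSpace hΩ_reg
  have hpos {Γ : Set (Pt d)} (hΓ : Γ ⊆ frontier Ω) (hΓ_pos : 0 < (μHE[d - 1] : Measure (Pt d)) Γ)
      (v : 𝓣.feSpace 1) (hv : v ≠ 0) :
      0 < (isBilinearMap_sForm hΩ_reg γ₁ γ₂ Γ).toLinearMap v v :=
    sForm_self_pos hd hΩ_reg hΩ_conn hγ₁ γ₂ hΓ hΓ_pos v.2 (by simpa using hv)
  have huniq := existsUnique_saddlePoint (isBilinearMap_aForm hΩ_reg κ ΓV ΓW).toLinearMap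
    (hpos hΓV hΓV_pos) (hpos hΓW hΓW_pos) ((isLinearMap_integral_mul hΩ_reg hf).mk' _)
    (-(isLinearMap_sForm hΩ_reg γ₁ γ₂ hu).mk' _)
  simp only [Subtype.forall] at huniq
  exact huniq

theorem mainTheorem10 (d : ℕ) (hd : d = 2 ∨ d = 3)
    (Ω : Set (CauchyFEM.Pt d)) (hΩ_conn : IsConnected Ω) (hΩ_reg : interior (closure Ω) = Ω)
    (𝓣 : CauchyFEM.Triangulation Ω)
    (ΓV ΓW : Set (CauchyFEM.Pt d)) (hΓ : CauchyFEM.IsCauchySplitting Ω ΓV ΓW)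
    (κ : ℝ) (γ₁ γ₂ : Finset (CauchyFEM.Pt d) → ℝ)
    (hγ₁ : ∀ F ∈ 𝓣.interiorFaces, 0 < γ₁ F) (hγ₂ : ∀ F ∈ 𝓣.interiorFaces, 0 < γ₂ F)
    (f : CauchyFEM.Pt d → ℝ) (hf : MemLp f 2 (volume.restrict Ω))
    (u : CauchyFEM.Pt d → ℝ) (hu : 𝓣.StabDefined 1 ΓV u) :
    ∃! p : 𝓣.feSpace 1 × 𝓣.feSpace 1,
      𝓣.IsFEMSolution 1 κ γ₁ γ₂ ΓV ΓW f u p.1 p.2 := by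
  have : IsFiniteMeasure (volume.restrict Ω) :=
    isFiniteMeasure_restrict.2 𝓣.isBounded.measure_lt_top.ne
  exact mainTheorem10_general (by omega) hΩ_conn.isPreconnected hΩ_reg 𝓣 hΓ.subset_V hΓ.subset_W
    hΓ.measure_pos_V hΓ.measure_pos_W κ hγ₁ γ₂ (hf.integrable one_le_two) hu
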